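/- Model. A weighted directed graph $G=(V,E,w)$ has $n$ nodes with distinct identifiers in $\{0,\dots,n^{\iota}-1\}$ and edge weights in a set $\mathcal W_n$ of integers with $0\le w\le n^{\kappa}$ for all $w\in\mathcal W_n$ ($\iota,\kappa$ constants; e.g. $\mathcal W_n=\{0,\dots,n^\kappa\}$ or $\{1,\dots,n^\kappa\}$). Its underlying undirected simple graph is connected and serves as the communication network; $D$ denotes the diameter of this undirected, unweighted network. In the randomized $\mathsf{CONGEST}$ model, every node initially knows $n$, $\varepsilon$, its identifier and its incident incoming and outgoing edges with their weights, and has private random bits; in each synchronous round it may send a (different) message of $O(\log n)$ bits to each neighbour in the network, and local computation is free. The algorithm has finished when all nodes have produced their final outputs. Let $d(u,v)\in\mathbb N\cup\{\infty\}$ be the least weight of a directed path from $u$ to $v$ ($\infty$ if there is none), $\mathrm{ecc}(v)=\max_{u\in V} d(v,u)$; the radius is $\min_v \mathrm{ecc}(v)$ and the diameter of $G$ is $\max_v \mathrm{ecc}(v)$. A value $\tilde x$ is an $\alpha$-approximation of $x$ if $x\le \tilde x\le\alpha x$. A $(1+\varepsilon)$-approximate SSSP algorithm, given a source $s$ known to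 all nodes, makes every node $v$ output a $(1+\varepsilon)$-approximation of $d(s,v)$. A set $C\subseteq V$ is a $\beta$-approximate pseudo-center if $\mathrm{ecc}(v)\ge\max_{u\in V}\min_{c\in C} d(c,u)/\beta$ for all $v\in V$. Theorem. For every $c$ there is $c_0$ such that the following holds. Let $\varepsilon\ge 0$ (possibly depending on $n$), and suppose that a (possibly randomized) $\mathsf{CONGEST}$ algorithm solves $(1+\varepsilon)$-approximate SSSP on all these weighted directed graphs, from every source, correctly and within $T(n,\varepsilon,D)$ rounds with probability at least $1-n^{-c_0}$. Then there is a randomized $\mathsf{CONGEST}$ algorithm which, on the same class of graphs, with probability at least $1-n^{-c}$ and within $\tilde O(T(n,\varepsilon,D)+D)$ rounds, i.e. at most $K\lfloor\log_2 n\rfloor^{k}\,(T(n,\varepsilon,D)+D)$ rounds, makes every node $v$ output $(2+\varepsilon^3+3\varepsilon^2+4\varepsilon)$-approximations of $\mathrm{ecc}(v)$, of the radius and of the diameter of $G$, and marks the nodes of a $(1+\varepsilon)^2$-approximate pseudo-center of at most $K\lfloor\log_2 n\rfloor^2$ nodes. The constants $K,k$, and the constant in the $O(\log n)$ message size, depend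 only on $c,\kappa,\iota$ and on the constant in the message size of the given algorithm, and not on $n$, $\varepsilon$, $T$, $D$ or $\mathcal W_n$. -/

import Mathlib

open scoped ENNReal

noncomputable section

/-! ### Weighted directed graphs as networks -/

/-- A weighted directed graph whose underlying undirected graph is a connected communication
network. Nodes are named by their identifiers, which are natural numbers; `weight u v = some a`
means that there is an edge from `u` to `v`, of weight `a`. -/
structure Network where
  nodes : Finset ℕ
  weight : ℕ → ℕ → Option ℕ
  mem_of_edge : ∀ u v a, weight u v = some a → u ∈ nodes ∧ v ∈ nodes
  no_loop : ∀ v, weight v v = none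
  connected : (SimpleGraph.fromRel fun u v : nodes => (weight u v).isSome = true).Connected

namespace Network

variable (G : Network)

/-- The communication graph: `u` and `v` are linked if there is an edge between them, in either
direction. -/
def comm : SimpleGraph G.nodes :=
  SimpleGraph.fromRel fun u v : G.nodes => (G.weight u v).isSome = true

/-- The hop diameter `D`: the diameter of the undirected, unweighted communication graph. -/
def hopDiam : ℕ := G.comm.diam

/-- `G.HasWalk u v k`: there is a directed walk from `u` to `v` of total weight `k`. -/
inductive HasWalk : ℕ → ℕ → ℕ → Prop
  | nil (u : ℕ) : HasWalk u u 0
  | cons {u v x a k : ℕ} : G.weight u v = some a → HasWalk v x k → HasWalk u x (a + k)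

/-- The distance from `u` to `v`: the least total weight of a directed walk (equivalently, as
weights are non-negative, path) from `u` to `v`, and `⊤` if there is none. -/
def dist (u v : ℕ) : ℕ∞ := ⨅ (k : ℕ) (_ : G.HasWalk u v k), (k : ℕ∞)

/-- The eccentricity of `v`: the maximum distance out of `v`. -/
def ecc (v : ℕ) : ℕ∞ := ⨆ u ∈ G.nodes, G.dist v u

/-- The (weighted, directed) radius: the minimum eccentricity. -/
def radius : ℕ∞ := ⨅ v ∈ G.nodes, G.ecc v

/-- The (weighted, directed) diameter: the maximum eccentricity. -/
def diameter : ℕ∞ := ⨆ v ∈ G.nodes, G.ecc v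

/-- `C` is an `α`-approximate pseudo-center:
`ecc v ≥ max_u min_{c ∈ C} d(c, u) / α` for all nodes `v`. -/
def IsPseudoCenter (α : ℝ) (C : Finset ℕ) : Prop :=
  C ⊆ G.nodes ∧ ∀ v ∈ G.nodes,
    (⨆ u ∈ G.nodes, ⨅ c ∈ C, (G.dist c u : ℝ≥0∞) / ENNReal.ofReal α) ≤ (G.ecc v : ℝ≥0∞)

/-- The networks under consideration: `n` nodes, identifiers smaller than `n ^ ι`
(that is, of `O(log n)` bits), all edge weights in `𝓦`. -/
def InClass (n ι : ℕ) (𝓦 : Set ℕ) : Prop :=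
  G.nodes.card = n ∧ (∀ v ∈ G.nodes, v < n ^ ι) ∧ ∀ u v a, G.weight u v = some a → a ∈ 𝓦

end Network

/-! ### Randomized algorithms in the CONGEST model -/

/-- What a node knows about the network at the start: its own identifier and the weights of its
outgoing and incoming edges, indexed by the identifier of the other endpoint. -/
structure LocalView where
  self : ℕ
  outWeight : ℕ → Option ℕ
  inWeight : ℕ → Option ℕ

/-- The initial knowledge of the node `v` of `G`. -/
def Network.view (G : Network) (v : ℕ) : LocalView where
  self := v
  outWeight := fun u => G.weight v u
  inWeight := fun u => G.weight u v

/-- A synchronous message passing algorithm. Every node has a private random string, drawn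
uniformly from the finite set `Tape`, and starts from its local view, the problem input (known to
all nodes) and its random string. In every round it sends to each neighbour (given by identifier) a
message from the finite set `Msg`, or nothing, and updates its state according to
the messages received. Local computation is unrestricted. Once a node has produced its output, the
output is final. -/
structure CongestAlgorithm (Input Out : Type) where
  Tape : Type
  tapeFintype : Fintype Tape
  tapeNonempty : Nonempty Tape
  Msg : Type
  msgFintype : Fintype Msg
  State : Type
  init : LocalView → Input → Tape → State
  send : State → ℕ → Option Msg
  receive : State → (ℕ → Option Msg) → State
  output : State → Option Out
  output_final : ∀ s inbox o, output s = some o → output (receive s inbox) = some o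

attribute [instance] CongestAlgorithm.tapeFintype CongestAlgorithm.tapeNonempty
  CongestAlgorithm.msgFintype

namespace CongestAlgorithm

variable {Input Out : Type} (A : CongestAlgorithm Input Out) (G : Network)

/-- The messages that the node `v` receives in a round that starts in the configuration `σ`: its
neighbours in the communication graph, and only they, can send to it. -/
def inbox (σ : G.nodes → A.State) (v : G.nodes) : ℕ → Option A.Msg := by
  classical
  exact fun i =>
    if h : ∃ hi : i ∈ G.nodes, G.comm.Adj ⟨i, hi⟩ v then A.send (σ ⟨i, h.1⟩) v else none

/-- One synchronous round. -/
def round (σ : G.nodes → A.State) : G.nodes → A.State :=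
  fun v => A.receive (σ v) (A.inbox G σ v)

/-- The configuration after `t` rounds on input `x` with random strings `ρ`. -/
def config (x : Input) (ρ : G.nodes → A.Tape) (t : ℕ) : G.nodes → A.State :=
  (A.round G)^[t] fun v => A.init (G.view v) x (ρ v)

/-- Within `R` rounds, all nodes have produced outputs, and these satisfy `spec`. -/
def SucceedsWithin (x : Input) (R : ℕ) (spec : (G.nodes → Out) → Prop)
    (ρ : G.nodes → A.Tape) : Prop :=
  ∃ f : G.nodes → Out, (∀ v, A.output (A.config G x ρ R v) = some (f v)) ∧ spec f

/-- The probability, over independent uniform random strings of the nodes, that within `R`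
rounds all nodes have produced outputs and that these satisfy `spec`. -/
def successProb (x : Input) (R : ℕ) (spec : (G.nodes → Out) → Prop) : ℝ := by
  classical
  exact ((Finset.univ.filter fun ρ : G.nodes → A.Tape => A.SucceedsWithin G x R spec ρ).card : ℝ) /
    (Fintype.card (G.nodes → A.Tape) : ℝ)

end CongestAlgorithm

/-! ### The problems -/

/-- `est` is an `α`-approximation (from above) of `x`: `x ≤ est ≤ α x`. -/
def IsApprox (α : ℝ) (x : ℕ∞) (est : ℝ≥0∞) : Prop :=
  (x : ℝ≥0∞) ≤ est ∧ est ≤ ENNReal.ofReal α * (x : ℝ≥0∞)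

/-- `α`-approximate single source shortest paths from `s`: every node `v` outputs an
`α`-approximation of the distance from `s` to `v`. -/
def SSSPSpec (G : Network) (α : ℝ) (s : ℕ) (f : G.nodes → ℝ≥0∞) : Prop :=
  ∀ v : G.nodes, IsApprox α (G.dist s v) (f v)

/-- `A` solves `α`-approximate SSSP on the networks of the class given by `n`, `ι`, `𝓦`, from every
source, with messages of at most `b * log₂ n` bits, in `T D` rounds on networks of
hop diameter `D`, with probability at least `1 - 1 / n ^ c`. -/
def CongestAlgorithm.SolvesSSSP (A : CongestAlgorithm ℕ ℝ≥0∞) (n ι : ℕ) (𝓦 : Set ℕ) (α : ℝ)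
    (b c : ℕ) (T : ℕ → ℕ) : Prop :=
  Fintype.card A.Msg ≤ n ^ b ∧
    ∀ G : Network, G.InClass n ι 𝓦 → ∀ s ∈ G.nodes,
      1 - 1 / (n : ℝ) ^ c ≤ A.successProb G s (T G.hopDiam) (SSSPSpec G α s)

/-- What a node outputs in the computation of the distance parameters: an estimate of its own
eccentricity, estimates of the radius and of the diameter, and whether it belongs to the
pseudo-center. -/
structure EccOutput where
  ecc : ℝ≥0∞
  radius : ℝ≥0∞
  diameter : ℝ≥0∞
  inCenter : Bool

/-- The nodes that declare themselves members of the pseudo-center. -/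
def centerOf (G : Network) (f : G.nodes → EccOutput) : Finset ℕ :=
  (G.nodes.attach.filter fun v => (f v).inCenter = true).image Subtype.val

/-- The outputs are `α`-approximations of all eccentricities, of the radius and of the diameter,
and the nodes marked form a `β`-approximate pseudo-center of at most `m` nodes. -/
def EccSpec (G : Network) (α β : ℝ) (m : ℕ) (f : G.nodes → EccOutput) : Prop :=
  (∀ v : G.nodes, IsApprox α (G.ecc v) (f v).ecc ∧ IsApprox α G.radius (f v).radius ∧
    IsApprox α G.diameter (f v).diameter) ∧
  G.IsPseudoCenter β (centerOf G f) ∧ (centerOf G f).card ≤ m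

/-- `A` computes `α`-approximations of all eccentricities, the radius and the diameter, and a
`β`-approximate pseudo-center of at most `m` nodes, on the networks of the class given by `n`, `ι`,
`𝓦`, with messages of at most `b * log₂ n` bits, in `R D` rounds on networks of hop diameter `D`,
with probability at least `1 - 1 / n ^ c`. -/
def CongestAlgorithm.SolvesEcc (A : CongestAlgorithm Unit EccOutput) (n ι : ℕ) (𝓦 : Set ℕ)
    (α β : ℝ) (m b c : ℕ) (R : ℕ → ℕ) : Prop :=
  Fintype.card A.Msg ≤ n ^ b ∧
    ∀ G : Network, G.InClass n ι 𝓦 →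
      1 - 1 / (n : ℝ) ^ c ≤ A.successProb G () (R G.hopDiam) (EccSpec G α β m)

end

/-! Write a = 1 + ε. The algorithm builds a small set `C` and estimates distances from and to it. By
the triangle inequality ecc(v) ≤ max_c d(v,c) + max_u min_c d(c,u). The estimate of the first term
is at most a·ecc(v). If `C` is a pseudo-center in the sense that the estimate of the second term is
at most a²·ecc(v), the sum of the estimates approximates ecc(v) within a + a² ≤ a + a³ = 2 + 4ε +
3ε² + ε³. The minimum and maximum of these sums then approximate radius and diameter
(`eccSpec_of_invariant`).

`C` arises from random elimination. At first all nodes are candidates. A phase adds a random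
candidate to `C`, finds the node u whose estimated distance from `C` is largest, and discards each
candidate v for which this distance is at most a times the estimate of d(v,u). A discarded v has
ecc(v) ≥ d(v,u), which yields the pseudo-center inequality (`invariant_phaseStep`); a surviving v is
strictly closer to u than every member of `C` (`dist_lt_of_cand_phaseStep`). If u were fixed in
advance, a sample among the half of the candidates closer to u would remove at least half of them.
But u depends on the sample. Phases are therefore grouped into batches of O(log n): for each fixed
u, all samples of a batch of m phases miss the closer half with probability at most (3/4)^m
(`prob_forall_misses_le`), and a union bound over u covers the node selected at the end of the
batch. So each batch halves the candidates (`two_mul_card_candidates_le`), and log n + 1 batches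
leave none.

The nodes know neither T nor D. They try the guesses g = 1, 2, 4, … with the same random strings. A
guess is accepted only if flooding certifies that the hop diameter is at most 2g and every simulated
run has produced its outputs within g rounds (`bad_verify_eq_false`). Since outputs are final, any
accepted guess yields the result that T rounds would have given (`result_program`), and when the
simulated runs succeed a guess with g ≥ T and g ≥ D is always accepted (`isSome_result_program`). -/

noncomputable section

/-! ### Edge reversal, directed distances and the hop diameter -/

namespace Network

variable (G : Network)

/-- The network with all edges reversed if `b` is true, and the network itself otherwise. -/
def orient (b : Bool) : Network where
  nodes := G.nodes
  weight u v := if b then G.weight v u else G.weight u v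
  mem_of_edge u v a h := by
    cases b
    · exact G.mem_of_edge u v a h
    · exact (G.mem_of_edge v u a h).symm
  no_loop v := by simp [G.no_loop]
  connected := by
    convert G.connected using 1
    ext u v
    cases b
    · rfl
    · simp [SimpleGraph.fromRel_adj, or_comm]

theorem orient_comm (b : Bool) : ((G.orient b).comm : SimpleGraph G.nodes) = G.comm := by
  ext u v
  cases b
  · rfl
  · exact and_congr_right fun _ => or_comm

theorem orient_hopDiam (b : Bool) : (G.orient b).hopDiam = G.hopDiam :=
  congrArg SimpleGraph.diam (G.orient_comm b)

theorem orient_inClass {n ι : ℕ} {𝓦 : Set ℕ} (h : G.InClass n ι 𝓦) (b : Bool) :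
    (G.orient b).InClass n ι 𝓦 := by
  refine ⟨h.1, h.2.1, fun u v a => ?_⟩
  cases b
  · exact h.2.2 u v a
  · exact h.2.2 v u a

variable {G}

theorem HasWalk.append {u v x k l : ℕ} (h : G.HasWalk u v k) (h' : G.HasWalk v x l) :
    G.HasWalk u x (k + l) := by
  induction h with
  | nil => simpa using h'
  | cons e _ ih => rw [add_assoc]; exact .cons e (ih h')

theorem HasWalk.orient_true {u v k : ℕ} (h : G.HasWalk u v k) :
    (G.orient true).HasWalk v u k := by
  induction h with
  | nil => exact .nil _
  | @cons u v x a k e _ ih =>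
    have : (G.orient true).HasWalk v u (a + 0) :=
      .cons (by simpa [orient] using e) (.nil u)
    simpa [add_comm] using ih.append this

theorem hasWalk_orient_true {u v k : ℕ} :
    (G.orient true).HasWalk u v k ↔ G.HasWalk v u k :=
  ⟨fun h => by simpa [orient] using h.orient_true, fun h => h.orient_true⟩

/-- Reversal turns single-source distances into distances to a common target, which is how the given
algorithm is used for both directions. -/
theorem dist_orient_true (u v : ℕ) : (G.orient true).dist u v = G.dist v u := by
  simp [dist, hasWalk_orient_true]

theorem dist_le_of_hasWalk {u v k : ℕ} (h : G.HasWalk u v k) : G.dist u v ≤ k :=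
  iInf₂_le k h

theorem exists_hasWalk_of_dist_ne_top {u v : ℕ} (h : G.dist u v ≠ ⊤) :
    ∃ k, G.HasWalk u v k ∧ G.dist u v = k := by
  have hne : ∃ k, G.HasWalk u v k := by
    by_contra! hc
    exact h (by simp [dist, hc])
  classical
  refine ⟨Nat.find hne, Nat.find_spec hne, le_antisymm (dist_le_of_hasWalk (Nat.find_spec hne)) ?_⟩
  exact le_iInf₂ fun k hk => by exact_mod_cast Nat.find_min' hne hk

theorem dist_triangle (u v x : ℕ) : G.dist u x ≤ G.dist u v + G.dist v x := by
  by_cases h : G.dist u v = ⊤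
  · simp [h]
  by_cases h' : G.dist v x = ⊤
  · simp [h']
  obtain ⟨k, hk, e⟩ := exists_hasWalk_of_dist_ne_top h
  obtain ⟨l, hl, e'⟩ := exists_hasWalk_of_dist_ne_top h'
  rw [e, e']
  exact_mod_cast dist_le_of_hasWalk (hk.append hl)

theorem dist_le_ecc (v : ℕ) {u : ℕ} (hu : u ∈ G.nodes) : G.dist v u ≤ G.ecc v :=
  le_iSup₂ (f := fun u (_ : u ∈ G.nodes) => G.dist v u) u hu

/-- There is an edge from `u` to `v`, and `u` lies in `X`. -/
def EdgeFrom (G : Network) (X : Finset ℕ) (u v : ℕ) : Prop :=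
  u ∈ X ∧ ∃ a, G.weight u v = some a

/-- Loop removal: cut the walk after its last departure from `u`; what follows never leaves `u`
again. -/
theorem reflTransGen_erase {X : Finset ℕ} (u : ℕ) {y v : ℕ}
    (h : Relation.ReflTransGen (G.EdgeFrom X) y v) :
    Relation.ReflTransGen (G.EdgeFrom (X.erase u)) y v ∨
      u ∈ X ∧ ∃ z a, G.weight u z = some a ∧
        Relation.ReflTransGen (G.EdgeFrom (X.erase u)) z v := by
  induction h using Relation.ReflTransGen.head_induction_on with
  | refl => exact .inl .refl
  | @head y z e _ ih =>
    rcases ih with ih | ih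
    · by_cases hy : y = u
      · subst hy
        obtain ⟨hX, a, ha⟩ := e
        exact .inr ⟨hX, z, a, ha, ih⟩
      · exact .inl (.head ⟨Finset.mem_erase.2 ⟨hy, e.1⟩, e.2⟩ ih)
    · exact .inr ih

/-- By loop removal each node of `X` need be left only once, at cost at most `w`; the induction
erases the node just left. -/
theorem exists_hasWalk_le_card_mul {w : ℕ} (hw : ∀ u v a, G.weight u v = some a → a ≤ w) :
    ∀ (m : ℕ) (X : Finset ℕ), X.card ≤ m → ∀ u v,
      Relation.ReflTransGen (G.EdgeFrom X) u v → ∃ k ≤ m * w, G.HasWalk u v k := by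
  intro m
  induction m with
  | zero =>
    intro X hX u v h
    rcases h.cases_head with rfl | ⟨z, e, _⟩
    · exact ⟨0, Nat.zero_le _, .nil _⟩
    · rw [Nat.le_zero, Finset.card_eq_zero] at hX
      exact absurd e.1 (by simp [hX])
  | succ m ih =>
    intro X hX u v h
    have step : u ∈ X → ∀ z a, G.weight u z = some a →
        Relation.ReflTransGen (G.EdgeFrom (X.erase u)) z v →
        ∃ k ≤ (m + 1) * w, G.HasWalk u v k := by
      intro hu z a ha hz
      have hc : (X.erase u).card ≤ m := by rw [Finset.card_erase_of_mem hu]; omega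
      obtain ⟨k, hk, hwalk⟩ := ih _ hc z v hz
      exact ⟨a + k, by have := hw _ _ _ ha; rw [add_mul]; omega, .cons ha hwalk⟩
    rcases h.cases_head with rfl | ⟨z, ⟨hu, a, ha⟩, hz⟩
    · exact ⟨0, Nat.zero_le _, .nil _⟩
    · rcases reflTransGen_erase u hz with h | ⟨_, z', a', ha', hz'⟩
      · exact step hu z a ha h
      · exact step hu z' a' ha' hz'

theorem HasWalk.reflTransGen {u v k : ℕ} (h : G.HasWalk u v k) :
    Relation.ReflTransGen (G.EdgeFrom G.nodes) u v := by
  induction h with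
  | nil => exact .refl
  | @cons u v x a k e _ ih => exact .head ⟨(G.mem_of_edge _ _ _ e).1, a, e⟩ ih

/-- Finite distances are polynomially bounded, so they can be sent in messages of O(log n) bits. -/
theorem dist_eq_top_or_le {w : ℕ} (hw : ∀ u v a, G.weight u v = some a → a ≤ w) (u v : ℕ) :
    G.dist u v = ⊤ ∨ G.dist u v ≤ (G.nodes.card * w : ℕ) := by
  refine or_iff_not_imp_left.2 fun h => ?_
  obtain ⟨k, hk, -⟩ := exists_hasWalk_of_dist_ne_top h
  obtain ⟨l, hl, hl'⟩ := exists_hasWalk_le_card_mul hw _ _ le_rfl _ _ hk.reflTransGen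
  exact (dist_le_of_hasWalk hl').trans (by exact_mod_cast hl)

theorem comm_connected : G.comm.Connected := G.connected

theorem comm_dist_le_hopDiam (v w : G.nodes) : G.comm.dist v w ≤ G.hopDiam := by
  have := comm_connected (G := G)
  have := this.nonempty
  exact SimpleGraph.dist_le_diam (SimpleGraph.connected_iff_ediam_ne_top.1 comm_connected)

theorem hopDiam_pos (h : 1 < G.nodes.card) : 0 < G.hopDiam := by
  obtain ⟨a, ha, b, hb, hab⟩ := Finset.one_lt_card.1 h
  refine lt_of_lt_of_le ?_ (comm_dist_le_hopDiam ⟨a, ha⟩ ⟨b, hb⟩)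
  exact comm_connected.pos_dist_of_ne (by simpa using hab)

end Network

/-- The local view of a node in the network in which the edges are reversed if `b` is true. -/
def LocalView.orient (L : LocalView) (b : Bool) : LocalView where
  self := L.self
  outWeight := if b then L.inWeight else L.outWeight
  inWeight := if b then L.outWeight else L.inWeight

theorem Network.view_orient (G : Network) (b : Bool) (v : ℕ) :
    (G.orient b).view v = (G.view v).orient b := by
  cases b <;> rfl

/-! ### Rounds as program steps -/

/-- The messages that `v` receives if `m w i` is what `w` sends to the neighbour `i`. -/
def Network.gather (G : Network) {Msg : Type} (m : G.nodes → ℕ → Option Msg) (v : G.nodes) :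
    ℕ → Option Msg := by
  classical
  exact fun i =>
    if h : ∃ hi : i ∈ G.nodes, G.comm.Adj ⟨i, hi⟩ v then m ⟨i, h.1⟩ v else none

theorem Network.gather_eq_some_iff {G : Network} {Msg : Type} {m : G.nodes → ℕ → Option Msg}
    {v : G.nodes} {i : ℕ} {x : Msg} :
    G.gather m v i = some x ↔ ∃ w : G.nodes, w.1 = i ∧ G.comm.Adj w v ∧ m w v = some x := by
  unfold Network.gather
  split_ifs with h
  · constructor
    · exact fun hx => ⟨⟨i, h.1⟩, rfl, h.2, hx⟩
    · rintro ⟨w, rfl, -, hx⟩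
      exact hx
  · simp only [false_iff]
    rintro ⟨w, rfl, hw, -⟩
    exact h ⟨w.2, hw⟩

theorem Network.gather_map_inl {G : Network} {Msg Msg' : Type} (m : G.nodes → ℕ → Option Msg)
    (v : G.nodes) :
    (fun i => (G.gather (fun w j => (m w j).map (Sum.inl (β := Msg'))) v i).bind Sum.getLeft?) =
      G.gather m v := by
  funext i
  unfold Network.gather
  split_ifs with h
  · rcases h' : m ⟨i, h.1⟩ v <;> simp [h']
  · rfl

theorem Network.orient_adj (G : Network) (b : Bool) (v w : G.nodes) :
    (G.orient b).comm.Adj v w ↔ G.comm.Adj v w :=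
  Iff.of_eq (congrArg (fun H : SimpleGraph G.nodes => H.Adj v w) (G.orient_comm b))

theorem Network.gather_orient (G : Network) (b : Bool) {Msg : Type}
    (m : G.nodes → ℕ → Option Msg) (v : G.nodes) :
    (G.orient b).gather m v = G.gather m v := by
  funext i
  ext x
  refine (gather_eq_some_iff (G := G.orient b)).trans (Iff.trans ?_ gather_eq_some_iff.symm)
  exact exists_congr fun w => and_congr_right fun _ => and_congr_left fun _ => G.orient_adj b w v

theorem CongestAlgorithm.config_succ {Input Out : Type} (A : CongestAlgorithm Input Out)
    (G : Network) (x : Input) (ρ : G.nodes → A.Tape) (t : ℕ) :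
    A.config G x ρ (t + 1) = A.round G (A.config G x ρ t) :=
  Function.iterate_succ_apply' _ _ _

theorem CongestAlgorithm.output_config_of_le {Input Out : Type} (A : CongestAlgorithm Input Out)
    {G : Network} {x : Input} {ρ : G.nodes → A.Tape} {s t : ℕ} (h : s ≤ t) {v : G.nodes} {o : Out}
    (ho : A.output (A.config G x ρ s v) = some o) : A.output (A.config G x ρ t v) = some o := by
  induction t, h using Nat.le_induction with
  | base => exact ho
  | succ t _ ih =>
    rw [config_succ]
    exact A.output_final _ _ _ ih

/-- Reversal leaves the communication graph unchanged, so a run on the reversed network takes place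
on `G` itself once every node swaps its incoming and outgoing edges. -/
theorem CongestAlgorithm.config_orient {Input Out : Type} (A : CongestAlgorithm Input Out)
    (G : Network) (b : Bool) (x : Input) (ρ : G.nodes → A.Tape) (t : ℕ) :
    (A.config (G.orient b) x ρ t : G.nodes → A.State) =
      (fun σ v => A.receive (σ v) (G.gather (fun w => A.send (σ w)) v))^[t]
        fun v => A.init ((G.view v).orient b) x (ρ v) := by
  have h : (A.round (G.orient b) : (G.nodes → A.State) → G.nodes → A.State) =
      fun σ v => A.receive (σ v) (G.gather (fun w => A.send (σ w)) v) := by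
    funext σ v
    exact congrArg (A.receive (σ v)) (G.gather_orient b (fun w => A.send (σ w)) v)
  unfold CongestAlgorithm.config
  rw [h]
  congr 1
  funext v
  rw [← G.view_orient b]

/-- One round of a program: what to send, and how to change the state. -/
structure Step (St Msg : Type) where
  send : St → ℕ → Option Msg
  recv : St → (ℕ → Option Msg) → St

namespace Step

variable {St Msg Out : Type} (G : Network)

/-- The effect of one round. -/
def run (p : Step St Msg) (σ : G.nodes → St) : G.nodes → St :=
  fun v => p.recv (σ v) (G.gather (fun w => p.send (σ w)) v)

/-- The effect of a list of rounds. -/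
def runList : List (Step St Msg) → (G.nodes → St) → G.nodes → St
  | [], σ => σ
  | p :: l, σ => runList l (p.run G σ)

@[simp] theorem runList_nil (σ : G.nodes → St) : runList (Msg := Msg) G [] σ = σ := rfl

@[simp] theorem runList_cons (p : Step St Msg) (l : List (Step St Msg)) (σ : G.nodes → St) :
    runList G (p :: l) σ = runList G l (p.run G σ) := rfl

theorem runList_append (l l' : List (Step St Msg)) (σ : G.nodes → St) :
    runList G (l ++ l') σ = runList G l' (runList G l σ) := by
  induction l generalizing σ with
  | nil => rfl
  | cons p l ih => exact ih _

theorem runList_replicate (p : Step St Msg) (t : ℕ) (σ : G.nodes → St) :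
    runList G (List.replicate t p) σ = (p.run G)^[t] σ := by
  induction t generalizing σ with
  | zero => rfl
  | succ t ih => exact ih _

/-- A silent round, used for a local computation. -/
def silent (f : St → St) : Step St Msg := ⟨fun _ _ => none, fun s _ => f s⟩

@[simp] theorem silent_run (f : St → St) (σ : G.nodes → St) :
    (silent f : Step St Msg).run G σ = fun v => f (σ v) := rfl

/-- The algorithm that runs the programs `prog 0`, `prog 1`, … one after the other, always from the
same initial state, until the state reached after one of them yields a result. -/
def repeatUntil (Tape : Type) [Fintype Tape] [Nonempty Tape] [Fintype Msg]
    (start : LocalView → Tape → St) (prog : ℕ → List (Step St Msg)) (result : St → Option Out) :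
    CongestAlgorithm Unit Out where
  Tape := Tape
  tapeFintype := inferInstance
  tapeNonempty := inferInstance
  Msg := Msg
  msgFintype := inferInstance
  State := St × ℕ × List (Step St Msg) × St × Option Out
  init L _ ω := (start L ω, 0, prog 0, start L ω, none)
  send s := match s with
    | (_, _, [], _, _) => fun _ => none
    | (_, _, p :: _, s, _) => p.send s
  receive s inbox := match s with
    -- The restart state `s₀` contains the random string, so all guesses repeat the same random
    -- experiment and no union bound over guesses is needed.
    | (s₀, i, [], s, o) => (s₀, i + 1, prog (i + 1), s₀, o <|> result s)
    | (s₀, i, p :: l, s, o) => (s₀, i, l, p.recv s inbox, o)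
  output s := s.2.2.2.2
  output_final := by
    rintro ⟨s₀, i, _ | ⟨p, l⟩, s, o⟩ inbox o' h
    · simp only at h
      simp [h]
    · exact h

/-- The number of rounds that the first `i` programs take. -/
def elapsed (prog : ℕ → List (Step St Msg)) : ℕ → ℕ
  | 0 => 0
  | i + 1 => elapsed prog i + ((prog i).length + 1)

/-- A geometric sum: all programs before the `i`-th together cost no more than the bound for the
`i`-th. -/
theorem elapsed_le (prog : ℕ → List (Step St Msg)) {Q : ℕ} (hQ : ∀ i, (prog i).length + 1 ≤ Q * 2 ^ i) (i : ℕ) :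
    elapsed prog i ≤ Q * 2 ^ i := by
  induction i with
  | zero => exact Nat.zero_le _
  | succ i ih =>
    rw [elapsed, pow_succ, ← mul_assoc, mul_two]
    exact add_le_add ih (hQ i)

section repeatUntil

variable {G} {Tape : Type} [Fintype Tape] [Nonempty Tape] [Fintype Msg]
  (start : LocalView → Tape → St) (prog : ℕ → List (Step St Msg)) (result : St → Option Out)
  (ρ : G.nodes → Tape)

/-- The state after the `i`-th program. -/
def finalState (i : ℕ) : G.nodes → St :=
  runList G (prog i) fun v : G.nodes => start (G.view v) (ρ v)

/-- The output determined by the first `i` programs. -/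
def outputAfter (v : G.nodes) : ℕ → Option Out
  | 0 => none
  | i + 1 => outputAfter v i <|> result (finalState start prog ρ i v)

theorem repeatUntil_run (i : ℕ) (o : G.nodes → Option Out) (s₀ : G.nodes → St)
    (l : List (Step St Msg)) (σ : G.nodes → St) :
    ((repeatUntil Tape start prog result).round G)^[l.length]
      (fun v => (s₀ v, i, l, σ v, o v)) = fun v => (s₀ v, i, [], runList G l σ v, o v) := by
  induction l generalizing σ with
  | nil => rfl
  | cons p l ih =>
    exact ih (p.run G σ)

theorem repeatUntil_config (i : ℕ) :
    (repeatUntil Tape start prog result).config G () ρ (elapsed prog i) =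
      fun v : G.nodes => (start (G.view v) (ρ v), i, prog i, start (G.view v) (ρ v),
        outputAfter start prog result ρ v i) := by
  induction i with
  | zero => rfl
  | succ i ih =>
    unfold CongestAlgorithm.config at ih ⊢
    rw [elapsed, add_comm, Function.iterate_add_apply, ih]
    refine (Function.iterate_succ_apply' _ _ _).trans ?_
    rw [repeatUntil_run start prog result i _ (fun v : G.nodes => start (G.view v) (ρ v))]
    rfl

/-- Nodes may stop at different guesses. This is harmless, because every result that is ever
accepted is the prescribed one. -/
theorem repeatUntil_output {f : G.nodes → Out}
    (h : ∀ i v o, result (finalState start prog ρ i v) = some o → o = f v) {i R : ℕ}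
    (hi : ∀ v, (result (finalState start prog ρ i v)).isSome) (hR : elapsed prog (i + 1) ≤ R)
    (v : G.nodes) :
    (repeatUntil Tape start prog result).output
      ((repeatUntil Tape start prog result).config G () ρ R v) = some (f v) := by
  refine CongestAlgorithm.output_config_of_le _ hR ?_
  rw [repeatUntil_config]
  change outputAfter start prog result ρ v (i + 1) = _
  have key : ∀ j o, outputAfter start prog result ρ v j = some o → o = f v := by
    intro j
    induction j with
    | zero => intro o ho; cases ho
    | succ j ih =>
      intro o ho
      rw [outputAfter, Option.orElse_eq_orElse, Option.orElse_eq_or, Option.or_eq_some_iff] at ho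
      rcases ho with ho | ho
      · exact ih o ho
      · exact h j v o ho.2
  have hs : (outputAfter start prog result ρ v (i + 1)).isSome := by
    rw [outputAfter, Option.orElse_eq_orElse, Option.orElse_eq_or, Option.isSome_or, hi v,
      Bool.or_true]
  obtain ⟨o, ho⟩ := Option.isSome_iff_exists.1 hs
  rw [ho, key _ o ho]

end repeatUntil

end Step

/-! ### The eccentricity algorithm -/

/-- An integer encoding of a distance estimate; `B` stands for `⊤`. -/
def quantize (B : ℕ) (e : ℝ≥0∞) : ℕ := if e = ⊤ then B else min ⌊e.toReal⌋₊ (B - 1)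

/-- The estimate encoded by an integer. -/
def unquantize (B : ℕ) (x : ℕ) : ℝ≥0∞ := if x < B then x else ⊤

theorem quantize_le (B : ℕ) (e : ℝ≥0∞) : quantize B e ≤ B := by
  unfold quantize
  split_ifs
  · exact le_rfl
  · exact (min_le_right _ _).trans (Nat.sub_le _ _)

/-- The numerical parameters of the eccentricity algorithm: identifiers are smaller than `idBound`,
`top` encodes an infinite distance, random ranks are at most `ranks`, there are `phases` phases, and
distance estimates are accurate up to the factor `ratio`. -/
structure Params where
  idBound : ℕ
  top : ℕ
  ranks : ℕ
  phases : ℕ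
  ratio : ℝ≥0∞

/-- A bound for the keys whose maximum is computed by flooding. -/
def Params.keyBound (p : Params) : ℕ := (p.ranks + p.top + 2) * p.idBound

/-- The key of a node with value `x` and identifier `id`. -/
def Params.key (p : Params) (x id : ℕ) : Fin (p.keyBound + 1) :=
  Fin.ofNat (p.keyBound + 1) (x * p.idBound + id)

theorem Params.key_val (p : Params) {x id : ℕ} (hx : x ≤ p.ranks + p.top + 1)
    (hid : id < p.idBound) : (p.key x id).val = x * p.idBound + id := by
  refine Nat.mod_eq_of_lt ?_
  have := Nat.mul_le_mul_right p.idBound hx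
  unfold keyBound
  rw [add_mul] at this ⊢
  omega

/-- The memory of a node: whether it is still a candidate, the node selected last, the estimates of
the distance from and to the pseudo-center, the maximal distance from the pseudo-center, membership
in the pseudo-center, and the extreme values of `top - toC` and `toC`. -/
structure Mem where
  cand : Bool
  cur : ℕ
  fromC : ℕ
  toC : ℕ
  mx : ℕ
  center : Bool
  lo : ℕ
  hi : ℕ

/-- Discard the node as a candidate if its estimated distance `e` to the selected node is large
enough. -/
def Mem.discard (p : Params) (m : Mem) (e : ℕ) : Mem := by
  classical
  exact { m with
    -- The factor `p.ratio` absorbs the error in the estimate `mx`: a candidate no closer to the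
    -- selected node than some center node is surely discarded.
    cand := m.cand && !decide (unquantize p.top m.mx ≤ p.ratio * unquantize p.top e) }

/-- The random bits that a node uses in one phase: a rank, and tapes for three runs of the shortest
path algorithm. -/
abbrev Coins (A : CongestAlgorithm ℕ ℝ≥0∞) (p : Params) : Type :=
  Fin (p.ranks + 1) × A.Tape × A.Tape × A.Tape

/-- The random bits of a node. -/
abbrev CoinTape (A : CongestAlgorithm ℕ ℝ≥0∞) (p : Params) : Type :=
  Fin (p.phases + 1) → Coins A p

/-- The messages of the eccentricity algorithm. -/
abbrev EccMsg (A : CongestAlgorithm ℕ ℝ≥0∞) (p : Params) : Type :=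
  A.Msg ⊕ Fin (p.keyBound + 1)

/-- The state of a node in the eccentricity algorithm. -/
structure Agent (A : CongestAlgorithm ℕ ℝ≥0∞) (p : Params) where
  view : LocalView
  coins : CoinTape A p
  mem : Mem
  bad : Bool
  reg : Fin (p.keyBound + 1)
  sub : Option A.State

namespace Agent

variable {A : CongestAlgorithm ℕ ℝ≥0∞} {p : Params}

/-- A round in which all nodes flood the largest key that they know. -/
def flood : Step (Agent A p) (EccMsg A p) := by
  classical
  exact
  { send := fun s _ => some (.inr s.reg)
    recv := fun s inbox => { s with
      reg := s.reg ⊔ (Finset.univ.filter fun k => ∃ i, inbox i = some (.inr k)).sup id } }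

/-- A round in which nodes with inconsistent neighbours raise the flag `bad`. -/
def check : Step (Agent A p) (EccMsg A p) := by
  classical
  exact
  { send := fun s _ => some (.inr s.reg)
    recv := fun s inbox => { s with
      reg := 0
      bad := s.bad || decide (∃ i k, inbox i = some (.inr k) ∧ k ≠ s.reg) } }

/-- A round in which the flag `bad` is passed on to all neighbours. -/
def flag : Step (Agent A p) (EccMsg A p) := by
  classical
  exact
  { send := fun s _ => if s.bad then some (.inr 0) else none
    recv := fun s inbox => { s with bad := s.bad || decide (∃ i, (inbox i).isSome) } }

/-- A round of the simulated algorithm. -/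
def simulate : Step (Agent A p) (EccMsg A p) where
  send s i := s.sub.bind fun τ => (A.send τ i).map Sum.inl
  recv s inbox := { s with
    sub := s.sub.map fun τ => A.receive τ fun i => (inbox i).bind Sum.getLeft? }

/-- Compute the maximum of `x` by flooding for `2 * g` rounds, and store it and the identifier of a
node that attains it. -/
def aggregate (x : Agent A p → ℕ) (store : ℕ → Mem → ℕ → ℕ → Mem) (g : ℕ) :
    List (Step (Agent A p) (EccMsg A p)) :=
  Step.silent (fun s => { s with reg := p.key (x s) s.view.self }) ::
    (List.replicate (2 * g) flood ++
      [Step.silent fun s => { s with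
        mem := store s.view.self s.mem (s.reg.val / p.idBound) (s.reg.val % p.idBound)
        reg := 0 }])

/-- Run the shortest path algorithm from the source `cur` for `g` rounds, and store the
estimates. -/
def shortestPaths (b : Bool) (tape : CoinTape A p → A.Tape) (store : Mem → ℕ → Mem) (g : ℕ) :
    List (Step (Agent A p) (EccMsg A p)) :=
  Step.silent (fun s => { s with
      sub := some (A.init (s.view.orient b) s.mem.cur (tape s.coins)) }) ::
    (List.replicate g simulate ++
      [Step.silent fun s => match s.sub.bind A.output with
        | none => { s with bad := true, sub := none }
        | some e => { s with mem := store s.mem (quantize p.top e), sub := none }])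

/-- The program of the `t`-th phase. -/
def phase (g t : ℕ) : List (Step (Agent A p) (EccMsg A p)) :=
  -- The `+ 1` ranks every candidate above all other nodes. Without candidates some node is still
  -- sampled, which does no harm.
  aggregate (fun s => if s.mem.cand then (s.coins (Fin.ofNat _ t)).1 + 1 else 0)
      (fun v m _ c => { m with cur := c, center := m.center || decide (v = c) }) g ++
    (shortestPaths false (fun ω => (ω (Fin.ofNat _ t)).2.1)
      (fun m e => { m with fromC := min m.fromC e }) g ++
    (shortestPaths true (fun ω => (ω (Fin.ofNat _ t)).2.2.1)
      (fun m e => { m with toC := max m.toC e }) g ++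
    (aggregate (fun s => s.mem.fromC) (fun _ m x u => { m with mx := x, cur := u }) g ++
    shortestPaths true (fun ω => (ω (Fin.ofNat _ t)).2.2.2)
      (fun m e => m.discard p e) g)))

/-- The programs of the first `t` phases. -/
def phases (g t : ℕ) : List (Step (Agent A p) (EccMsg A p)) :=
  (List.range t).flatMap (phase g)

/-- The program that computes the extreme values after all phases. -/
def extremes (g : ℕ) : List (Step (Agent A p) (EccMsg A p)) :=
  aggregate (fun s => s.mem.fromC) (fun _ m x _ => { m with mx := x }) g ++
    (aggregate (fun s => s.mem.toC) (fun _ m x _ => { m with hi := x }) g ++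
    -- Flooding computes maxima only; the minimum of `toC` is obtained from the maximum of its
    -- complement.
    aggregate (fun s => p.top - s.mem.toC) (fun _ m x _ => { m with lo := x }) g)

/-- The program that checks whether the rounds were sufficient. -/
def verify (g : ℕ) : List (Step (Agent A p) (EccMsg A p)) :=
  Step.silent (fun s => { s with reg := p.key 0 s.view.self }) ::
    -- Only `g` rounds of flooding here, against `2 * g` in `aggregate`: agreement after `g` rounds
    -- certifies that all hop distances are at most `2 * g`.
    (List.replicate g flood ++ (check :: List.replicate (2 * g + 1) flag))

/-- The program for the guess `g` of the number of rounds. -/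
def program (g : ℕ) : List (Step (Agent A p) (EccMsg A p)) :=
  phases g p.phases ++ extremes g ++ verify g

/-- The initial state of a node. -/
def start (L : LocalView) (ω : CoinTape A p) : Agent A p where
  view := L
  coins := ω
  -- For the empty center the minimum `fromC` is infinite, encoded by `p.top`, and the maximum `toC`
  -- is 0.
  mem := ⟨true, 0, p.top, 0, 0, false, 0, 0⟩
  bad := false
  reg := 0
  sub := none

/-- The output determined by the memory of a node. -/
def outputOf (p : Params) (m : Mem) : EccOutput where
  ecc := unquantize p.top m.toC + unquantize p.top m.mx
  radius := unquantize p.top (p.top - m.lo) + unquantize p.top m.mx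
  diameter := unquantize p.top m.hi + unquantize p.top m.mx
  inCenter := m.center

/-- The result of a run of the program. -/
def result (s : Agent A p) : Option EccOutput :=
  if s.bad then none else some (outputOf p s.mem)

end Agent

/-- The eccentricity algorithm. -/
def eccAlgorithm (A : CongestAlgorithm ℕ ℝ≥0∞) (p : Params) : CongestAlgorithm Unit EccOutput :=
  Step.repeatUntil (CoinTape A p) Agent.start (fun i => Agent.program (2 ^ i)) Agent.result

namespace Agent

variable {A : CongestAlgorithm ℕ ℝ≥0∞} {p : Params}

theorem length_aggregate (x : Agent A p → ℕ) (store : ℕ → Mem → ℕ → ℕ → Mem) (g : ℕ) :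
    (aggregate x store g).length = 2 * g + 2 := by
  simp [aggregate]

theorem length_shortestPaths (b : Bool) (tape : CoinTape A p → A.Tape) (store : Mem → ℕ → Mem)
    (g : ℕ) : (shortestPaths b tape store g).length = g + 2 := by
  simp [shortestPaths]

theorem length_program_le {g : ℕ} (hg : 1 ≤ g) :
    (program g : List (Step (Agent A p) (EccMsg A p))).length + 1 ≤ (17 * p.phases + 19) * g := by
  have h : (phases g p.phases : List (Step (Agent A p) (EccMsg A p))).length =
      p.phases * (7 * g + 10) := by
    have : ∀ t, (phase g t : List (Step (Agent A p) (EccMsg A p))).length = 7 * g + 10 := by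
      intro t
      simp only [phase, List.length_append, length_aggregate, length_shortestPaths]
      ring
    simp [phases, List.length_flatMap, this]
  have h' : (extremes g : List (Step (Agent A p) (EccMsg A p))).length = 6 * g + 6 := by
    simp only [extremes, List.length_append, length_aggregate]
    ring
  have h'' : (verify g : List (Step (Agent A p) (EccMsg A p))).length = 3 * g + 3 := by
    simp only [verify, List.length_append, List.length_cons, List.length_replicate]
    ring
  rw [program, List.length_append, List.length_append, h, h', h'']
  nlinarith [Nat.zero_le p.phases, Nat.mul_le_mul_left p.phases hg]

end Agent

/-! ### Flooding -/

/-- The largest pair `(f v, v)` in the lexicographic order, for a bound `P` of the identifiers. -/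
def Network.leader (G : Network) (P : ℕ) (f : G.nodes → ℕ) : ℕ × ℕ :=
  let k := Finset.univ.sup fun v : G.nodes => f v * P + v
  (k / P, k % P)

theorem Network.leader_eq {G : Network} {P : ℕ} (hP : ∀ v ∈ G.nodes, v < P) {f : G.nodes → ℕ}
    {w : G.nodes} (hw : ∀ v : G.nodes, f v * P + v ≤ f w * P + w) :
    G.leader P f = (f w, w.1) := by
  have : (Finset.univ.sup fun v : G.nodes => f v * P + v) = f w * P + w :=
    le_antisymm (Finset.sup_le fun v _ => hw v)
      (Finset.le_sup (f := fun v : G.nodes => f v * P + v) (Finset.mem_univ w))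
  have hwP := hP _ w.2
  simp only [leader, this]
  rw [mul_comm, Nat.mul_add_div (by omega), Nat.div_eq_of_lt hwP, Nat.mul_add_mod,
    Nat.mod_eq_of_lt hwP, add_zero]

theorem Network.leader_spec {G : Network} {P : ℕ} (hP : ∀ v ∈ G.nodes, v < P)
    (f : G.nodes → ℕ) :
    ∃ w : G.nodes, G.leader P f = (f w, w.1) ∧ ∀ v, f v ≤ f w := by
  have : Nonempty G.nodes := G.comm_connected.nonempty
  obtain ⟨w, hw⟩ := Finite.exists_max fun v : G.nodes => f v * P + v
  refine ⟨w, leader_eq hP hw, fun v => ?_⟩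
  by_contra! hc
  have h1 := hw v
  have h2 := Nat.mul_le_mul_right P hc
  have h3 := hP _ w.2
  rw [Nat.succ_mul] at h2
  omega

theorem SimpleGraph.Connected.exists_adj_dist {V : Type*} {H : SimpleGraph V} (hH : H.Connected)
    {v w : V} {t : ℕ} (h : H.dist v w = t + 1) : ∃ u, H.dist v u = t ∧ H.Adj u w := by
  obtain ⟨q, hq⟩ := hH.exists_walk_length_eq_dist w v
  rw [SimpleGraph.dist_comm, h] at hq
  cases q with
  | nil => simp at hq
  | @cons _ u _ hadj q =>
    refine ⟨u, le_antisymm ?_ ?_, hadj.symm⟩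
    · rw [SimpleGraph.dist_comm]
      exact (SimpleGraph.dist_le q).trans (by simpa using hq.le)
    · have h1 := hH.dist_triangle (u := v) (v := u) (w := w)
      have h2 : H.dist u w ≤ 1 := (SimpleGraph.dist_le (.cons hadj.symm .nil)).trans (by simp)
      omega

namespace Agent

variable {A : CongestAlgorithm ℕ ℝ≥0∞} {p : Params} {G : Network}

theorem flood_run_apply (σ : G.nodes → Agent A p) (v : G.nodes) :
    flood.run G σ v = { σ v with reg := (flood.run G σ v).reg } := rfl

theorem le_reg_flood (σ : G.nodes → Agent A p) (v : G.nodes) :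
    (σ v).reg ≤ (flood.run G σ v).reg :=
  le_sup_left

theorem le_reg_flood_of_adj (σ : G.nodes → Agent A p) {v w : G.nodes} (h : G.comm.Adj w v) :
    (σ w).reg ≤ (flood.run G σ v).reg := by
  classical
  refine le_trans ?_ le_sup_right
  refine Finset.le_sup (f := id) (Finset.mem_filter.2 ⟨Finset.mem_univ _, w.1, ?_⟩)
  exact Network.gather_eq_some_iff.2 ⟨w, rfl, h, rfl⟩

theorem reg_flood_cases (σ : G.nodes → Agent A p) (v : G.nodes) :
    (flood.run G σ v).reg = (σ v).reg ∨
      ∃ w, G.comm.Adj w v ∧ (flood.run G σ v).reg = (σ w).reg := by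
  classical
  obtain ⟨S, hS, hreg⟩ : ∃ S : Finset (Fin (p.keyBound + 1)),
      (∀ k ∈ S, ∃ i, G.gather (fun w => (flood : Step (Agent A p) (EccMsg A p)).send (σ w)) v i =
        some (.inr k)) ∧ (flood.run G σ v).reg = (σ v).reg ⊔ S.sup id :=
    ⟨_, fun k hk => (Finset.mem_filter.1 hk).2, rfl⟩
  rcases S.eq_empty_or_nonempty with h | h
  · left
    rw [hreg, h, Finset.sup_empty, sup_bot_eq]
  · obtain ⟨k, hk, hk'⟩ := Finset.exists_mem_eq_sup S h id
    rcases le_total ((σ v).reg) k with hle | hle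
    · right
      obtain ⟨i, hi⟩ := hS k hk
      obtain ⟨w, -, hw, e⟩ := Network.gather_eq_some_iff.1 hi
      refine ⟨w, hw, ?_⟩
      rw [hreg, hk', id, sup_eq_right.2 hle]
      exact (Sum.inr.inj (Option.some.inj e)).symm
    · left
      rw [hreg, hk', id, sup_eq_left.2 hle]

theorem flood_iterate_apply (σ : G.nodes → Agent A p) (t : ℕ) (v : G.nodes) :
    (flood.run G)^[t] σ v = { σ v with reg := ((flood.run G)^[t] σ v).reg } := by
  induction t with
  | zero => rfl
  | succ t ih =>
    rw [Function.iterate_succ_apply', flood_run_apply, ih]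

theorem le_reg_flood_iterate (σ : G.nodes → Agent A p) (t : ℕ) {v w : G.nodes}
    (h : G.comm.dist w v ≤ t) : (σ w).reg ≤ ((flood.run G)^[t] σ v).reg := by
  induction t generalizing v with
  | zero =>
    rw [(G.comm_connected.dist_eq_zero_iff).1 (Nat.le_zero.1 h)]
    rfl
  | succ t ih =>
    rw [Function.iterate_succ_apply']
    rcases h.lt_or_eq with h | h
    · exact (ih (Nat.lt_succ_iff.1 h)).trans (le_reg_flood _ v)
    · obtain ⟨u, hu, hadj⟩ := G.comm_connected.exists_adj_dist h
      exact (ih hu.le).trans (le_reg_flood_of_adj _ hadj)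

/-- Locality of flooding, the counterpart of `le_reg_flood_iterate`. Since keys in the verification
are distinct, a node that holds the key of `l` after `t` rounds is within distance `t` of `l`. -/
theorem exists_reg_flood_iterate (σ : G.nodes → Agent A p) (t : ℕ) (v : G.nodes) :
    ∃ w, G.comm.dist w v ≤ t ∧ ((flood.run G)^[t] σ v).reg = (σ w).reg := by
  induction t generalizing v with
  | zero => exact ⟨v, by simp, rfl⟩
  | succ t ih =>
    rw [Function.iterate_succ_apply']
    rcases reg_flood_cases ((flood.run G)^[t] σ) v with h | ⟨u, hu, h⟩
    · obtain ⟨w, hw, e⟩ := ih v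
      exact ⟨w, hw.trans (Nat.le_succ _), h.trans e⟩
    · obtain ⟨w, hw, e⟩ := ih u
      refine ⟨w, ?_, h.trans e⟩
      have h1 := G.comm_connected.dist_triangle (u := w) (v := u) (w := v)
      have h2 : G.comm.dist u v ≤ 1 := (SimpleGraph.dist_le (.cons hu .nil)).trans (by simp)
      omega

/-! ### Simulation of the building blocks -/

/-- The configuration with coins `ρ` and memories `μ` between two blocks of the program. -/
def idle (ρ : G.nodes → CoinTape A p) (μ : G.nodes → Mem) : G.nodes → Agent A p :=
  fun v => ⟨G.view v, ρ v, μ v, false, 0, none⟩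

/-- The program `l` changes the memories from `μ` to `μ'` in networks in which `T` rounds of the
shortest path algorithm suffice, provided that `T ≤ g` or that no node complains. -/
def Simulates (T g : ℕ) (ρ : G.nodes → CoinTape A p) (l : List (Step (Agent A p) (EccMsg A p)))
    (μ μ' : G.nodes → Mem) : Prop :=
  (T ≤ g ∨ ∀ v, (Step.runList G l (idle ρ μ) v).bad = false) →
    Step.runList G l (idle ρ μ) = idle ρ μ'

/-- No node withdraws a complaint in a step of the program `l`. -/
def Sticky (l : List (Step (Agent A p) (EccMsg A p))) : Prop :=
  ∀ q ∈ l, ∀ s inbox, (q.recv s inbox).bad = false → s.bad = false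

theorem Sticky.append {l l' : List (Step (Agent A p) (EccMsg A p))} (h : Sticky l)
    (h' : Sticky l') : Sticky (l ++ l') := by
  intro q hq
  rcases List.mem_append.1 hq with hq | hq
  · exact h q hq
  · exact h' q hq

theorem Sticky.bad_eq_false {l : List (Step (Agent A p) (EccMsg A p))} (h : Sticky l)
    {σ : G.nodes → Agent A p} {v : G.nodes} (hv : (Step.runList G l σ v).bad = false) :
    (σ v).bad = false := by
  induction l generalizing σ with
  | nil => exact hv
  | cons q l ih =>
    have := ih (fun q' hq' => h q' (List.mem_cons_of_mem _ hq')) hv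
    exact h q List.mem_cons_self _ _ this

theorem Simulates.append {T g : ℕ} {ρ : G.nodes → CoinTape A p}
    {l l' : List (Step (Agent A p) (EccMsg A p))} {μ μ' μ'' : G.nodes → Mem}
    (h : Simulates T g ρ l μ μ') (h' : Simulates T g ρ l' μ' μ'') (hl' : Sticky l') :
    Simulates T g ρ (l ++ l') μ μ'' := by
  intro hyp
  rw [Step.runList_append] at hyp ⊢
  have e := h (hyp.imp_right fun hb v => hl'.bad_eq_false (hb v))
  rw [e] at hyp ⊢
  exact h' hyp

theorem sticky_aggregate (x : Agent A p → ℕ) (store : ℕ → Mem → ℕ → ℕ → Mem) (g : ℕ) :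
    Sticky (aggregate x store g) := by
  intro q hq s inbox h
  simp only [aggregate, List.mem_cons, List.mem_append, List.not_mem_nil, or_false] at hq
  rcases hq with rfl | hq | rfl
  · exact h
  · rw [List.eq_of_mem_replicate hq] at h
    exact h
  · exact h

theorem sticky_shortestPaths (b : Bool) (tape : CoinTape A p → A.Tape) (store : Mem → ℕ → Mem)
    (g : ℕ) : Sticky (shortestPaths b tape store g) := by
  intro q hq s inbox h
  simp only [shortestPaths, List.mem_cons, List.mem_append, List.not_mem_nil, or_false] at hq
  rcases hq with rfl | hq | rfl
  · exact h
  · rw [List.eq_of_mem_replicate hq] at h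
    exact h
  · simp only [Step.silent] at h
    split at h
    · cases h
    · exact h

theorem sticky_phase (g t : ℕ) : Sticky (phase g t : List (Step (Agent A p) (EccMsg A p))) :=
  (sticky_aggregate _ _ _).append <| (sticky_shortestPaths _ _ _ _).append <|
    (sticky_shortestPaths _ _ _ _).append <| (sticky_aggregate _ _ _).append <|
      sticky_shortestPaths _ _ _ _

theorem sticky_extremes (g : ℕ) : Sticky (extremes g : List (Step (Agent A p) (EccMsg A p))) :=
  (sticky_aggregate _ _ _).append <| (sticky_aggregate _ _ _).append <| sticky_aggregate _ _ _

theorem simulates_aggregate {T g : ℕ} {ρ : G.nodes → CoinTape A p} {μ : G.nodes → Mem}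
    {x : Agent A p → ℕ} (store : ℕ → Mem → ℕ → ℕ → Mem)
    (hid : ∀ v ∈ G.nodes, v < p.idBound) (hg : ∀ v w, G.comm.dist v w ≤ 2 * g)
    (hx : ∀ v, x (idle ρ μ v) ≤ p.ranks + p.top + 1) :
    Simulates T g ρ (aggregate x store g) μ fun v =>
      store v (μ v) (G.leader p.idBound fun v => x (idle ρ μ v)).1
        (G.leader p.idBound fun v => x (idle ρ μ v)).2 := by
  intro _
  rw [aggregate, Step.runList_cons, Step.runList_append, Step.runList_replicate, Step.silent_run,
    Step.runList_cons, Step.runList_nil, Step.silent_run]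
  set σ : G.nodes → Agent A p := fun v =>
    { idle ρ μ v with reg := p.key (x (idle ρ μ v)) (idle ρ μ v).view.self } with hσ
  have hreg : ∀ v : G.nodes, (σ v).reg.val = x (idle ρ μ v) * p.idBound + v :=
    fun v => p.key_val (hx v) (hid v v.2)
  funext v
  obtain ⟨w, -, hw⟩ := exists_reg_flood_iterate σ (2 * g) v
  have hlead : G.leader p.idBound (fun v => x (idle ρ μ v)) = (x (idle ρ μ w), w.1) := by
    refine Network.leader_eq hid fun u => ?_
    rw [← hreg, ← hreg, ← hw]
    exact le_reg_flood_iterate σ (2 * g) (hg u v)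
  have hwP := hid _ w.2
  have h1 : ((flood.run G)^[2 * g] σ v).reg.val / p.idBound = x (idle ρ μ w) := by
    rw [hw, hreg, mul_comm, Nat.mul_add_div (by omega), Nat.div_eq_of_lt hwP, add_zero]
  have h2 : ((flood.run G)^[2 * g] σ v).reg.val % p.idBound = w := by
    rw [hw, hreg, mul_comm, Nat.mul_add_mod, Nat.mod_eq_of_lt hwP]
  rw [flood_iterate_apply, h1, h2, hlead]
  rfl

/-- The configuration in which `sub` holds the states `τ` of the simulated algorithm. -/
def running (ρ : G.nodes → CoinTape A p) (μ : G.nodes → Mem) (τ : G.nodes → A.State) :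
    G.nodes → Agent A p :=
  fun v => ⟨G.view v, ρ v, μ v, false, 0, some (τ v)⟩

theorem simulate_run_running (ρ : G.nodes → CoinTape A p) (μ : G.nodes → Mem)
    (τ : G.nodes → A.State) :
    simulate.run G (running ρ μ τ) =
      running ρ μ fun v => A.receive (τ v) (G.gather (fun w => A.send (τ w)) v) := by
  funext v
  have := Network.gather_map_inl (Msg' := Fin (p.keyBound + 1)) (fun w => A.send (τ w)) v
  simp only [Step.run, simulate, running, Option.map_some, Option.bind_some] at this ⊢
  rw [this]

theorem simulate_iterate_running (ρ : G.nodes → CoinTape A p) (μ : G.nodes → Mem)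
    (τ : G.nodes → A.State) (t : ℕ) :
    (simulate.run G)^[t] (running ρ μ τ) = running ρ μ
      ((fun σ v => A.receive (σ v) (G.gather (fun w => A.send (σ w)) v))^[t] τ) := by
  induction t with
  | zero => rfl
  | succ t ih => rw [Function.iterate_succ_apply', Function.iterate_succ_apply', ih,
      simulate_run_running]

/-- The output of a node after `T` rounds of the algorithm `A` from the source `s`, with reversed
edges if `b` is true. -/
def pathOutput (A : CongestAlgorithm ℕ ℝ≥0∞) (G : Network) (b : Bool) (s : ℕ)
    (r : G.nodes → A.Tape) (T : ℕ) (v : G.nodes) : Option ℝ≥0∞ :=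
  A.output (A.config (G.orient b) s r T v)

/-- The integer estimate of the distance to a node obtained in this way. -/
def estimate (p : Params) (A : CongestAlgorithm ℕ ℝ≥0∞) (G : Network) (T : ℕ) (b : Bool) (s : ℕ)
    (r : G.nodes → A.Tape) (v : G.nodes) : ℕ :=
  quantize p.top ((pathOutput A G b s r T v).getD 0)

/-- If `g < T` but no node complains, all outputs are already present after `g` rounds. Outputs are
final, so they are the ones present after `T` rounds. -/
theorem simulates_shortestPaths {T g : ℕ} {ρ : G.nodes → CoinTape A p} {μ : G.nodes → Mem}
    (b : Bool) (tape : CoinTape A p → A.Tape) (store : Mem → ℕ → Mem) {s : ℕ}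
    (hs : ∀ v, (μ v).cur = s)
    (hT : ∀ v, (pathOutput A G b s (fun v => tape (ρ v)) T v).isSome) :
    Simulates T g ρ (shortestPaths b tape store g) μ fun v =>
      store (μ v) (estimate p A G T b s (fun v => tape (ρ v)) v) := by
  intro hyp
  rw [shortestPaths, Step.runList_cons, Step.runList_append, Step.runList_replicate,
    Step.silent_run, Step.runList_cons, Step.runList_nil, Step.silent_run] at hyp ⊢
  have hrun : (fun v => { idle ρ μ v with sub := some (A.init ((idle ρ μ v).view.orient b)
        (idle ρ μ v).mem.cur (tape (idle ρ μ v).coins)) }) =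
      running ρ μ fun v : G.nodes => A.init ((G.view v).orient b) s (tape (ρ v)) := by
    funext v
    simp only [idle, running, hs]
  rw [hrun, simulate_iterate_running,
    ← A.config_orient G b s (fun v => tape (ρ v)) g] at hyp ⊢
  have hsome : ∀ v, (pathOutput A G b s (fun v => tape (ρ v)) g v).isSome := by
    intro v
    rcases hyp with hyp | hyp
    · obtain ⟨o, ho⟩ := Option.isSome_iff_exists.1 (hT v)
      exact Option.isSome_iff_exists.2 ⟨o, A.output_config_of_le hyp ho⟩
    · have h := hyp v
      simp only [running, Option.bind_some] at h
      split at h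
      · cases h
      · next e he => exact Option.isSome_iff_exists.2 ⟨e, he⟩
  funext v
  obtain ⟨o, ho⟩ := Option.isSome_iff_exists.1 (hT v)
  obtain ⟨o', ho'⟩ := Option.isSome_iff_exists.1 (hsome v)
  have hoo : o = o' := by
    rcases le_total T g with h | h
    · exact Option.some.inj ((A.output_config_of_le h ho).symm.trans ho')
    · exact Option.some.inj (ho.symm.trans (A.output_config_of_le h ho'))
  have ho'' : A.output (A.config (G.orient b) s (fun v => tape (ρ v)) g v) = some o' := ho'
  simp only [running, Option.bind_some, idle, estimate, ho, Option.getD_some, hoo]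
  split
  · next h => exact absurd (h.symm.trans ho'') nofun
  · next e h => rw [Option.some.inj (h.symm.trans ho'')]

end Agent

/-! ### The computation of the whole network -/

namespace Agent

variable {A : CongestAlgorithm ℕ ℝ≥0∞} {p : Params} {G : Network}

/-- The node that is sampled in a phase, given the ranks of the nodes and the candidates. -/
def sampled (p : Params) (G : Network) (r : G.nodes → Fin (p.ranks + 1)) (W : G.nodes → Bool) :
    ℕ :=
  (G.leader p.idBound fun v => if W v then (r v : ℕ) + 1 else 0).2

section phase

variable (T : ℕ) (ω : G.nodes → Coins A p) (μ : G.nodes → Mem)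

/-- The node that is sampled in a phase with coins `ω` and initial memories `μ`. -/
def sampledIn : ℕ := sampled p G (fun v => (ω v).1) fun v => (μ v).cand

/-- The distance estimates from the pseudo-center after the sampled node has been added. -/
def fromAfter (v : G.nodes) : ℕ :=
  min (μ v).fromC (estimate p A G T false (sampledIn ω μ) (fun w => (ω w).2.1) v)

/-- The distance estimates to the pseudo-center after the sampled node has been added. -/
def toAfter (v : G.nodes) : ℕ :=
  max (μ v).toC (estimate p A G T true (sampledIn ω μ) (fun w => (ω w).2.2.1) v)

/-- The largest estimate of a distance from the pseudo-center, and a node that attains it. -/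
def farthest : ℕ × ℕ := G.leader p.idBound (fromAfter T ω μ)

/-- The memories after a phase. -/
def phaseStep (v : G.nodes) : Mem :=
  Mem.discard p
    { μ v with
      cur := (farthest T ω μ).2
      fromC := fromAfter T ω μ v
      toC := toAfter T ω μ v
      mx := (farthest T ω μ).1
      center := (μ v).center || decide (v.1 = sampledIn ω μ) }
    (estimate p A G T true (farthest T ω μ).2 (fun w => (ω w).2.2.2) v)

/-- All three runs of the shortest path algorithm in a phase succeed. -/
def RunsSucceed (α : ℝ) : Prop :=
  A.SucceedsWithin (G.orient false) (sampledIn ω μ) T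
      (SSSPSpec (G.orient false) α (sampledIn ω μ)) (fun w => (ω w).2.1) ∧
    A.SucceedsWithin (G.orient true) (sampledIn ω μ) T
      (SSSPSpec (G.orient true) α (sampledIn ω μ)) (fun w => (ω w).2.2.1) ∧
    A.SucceedsWithin (G.orient true) (farthest T ω μ).2 T
      (SSSPSpec (G.orient true) α (farthest T ω μ).2) (fun w => (ω w).2.2.2)

end phase

/-- The memories after `t` phases. -/
def memAfter (T : ℕ) (ρ : G.nodes → CoinTape A p) : ℕ → G.nodes → Mem
  | 0 => fun _ => ⟨true, 0, p.top, 0, 0, false, 0, 0⟩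
  | t + 1 => phaseStep T (fun v => ρ v (Fin.ofNat _ t)) (memAfter T ρ t)

/-- The memories after the extreme values have been computed. -/
def withExtremes (p : Params) (μ : G.nodes → Mem) (v : G.nodes) : Mem :=
  { μ v with
    mx := (G.leader p.idBound fun w => (μ w).fromC).1
    hi := (G.leader p.idBound fun w => (μ w).toC).1
    lo := (G.leader p.idBound fun w => p.top - (μ w).toC).1 }

theorem isSome_pathOutput {b : Bool} {s T : ℕ} {r : G.nodes → A.Tape}
    {spec : (G.nodes → ℝ≥0∞) → Prop} (h : A.SucceedsWithin (G.orient b) s T spec r)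
    (v : G.nodes) : (pathOutput A G b s r T v).isSome := by
  obtain ⟨f, hf, -⟩ := h
  exact Option.isSome_iff_exists.2 ⟨f v, hf v⟩

theorem fromC_memAfter_le (T : ℕ) (ρ : G.nodes → CoinTape A p) (t : ℕ) (v : G.nodes) :
    (memAfter T ρ t v).fromC ≤ p.top := by
  induction t with
  | zero => exact le_rfl
  | succ t ih => exact (min_le_left _ _).trans ih

theorem toC_memAfter_le (T : ℕ) (ρ : G.nodes → CoinTape A p) (t : ℕ) (v : G.nodes) :
    (memAfter T ρ t v).toC ≤ p.top := by
  induction t with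
  | zero => exact Nat.zero_le _
  | succ t ih => exact max_le ih (quantize_le _ _)

theorem simulates_phase {T g t : ℕ} {α : ℝ} {ρ : G.nodes → CoinTape A p} {μ : G.nodes → Mem}
    (hid : ∀ v ∈ G.nodes, v < p.idBound) (hg : ∀ v w, G.comm.dist v w ≤ 2 * g)
    (hμ : ∀ v, (μ v).fromC ≤ p.top)
    (hruns : RunsSucceed T (fun v => ρ v (Fin.ofNat _ t)) μ α) :
    Simulates T g ρ (phase g t) μ (phaseStep T (fun v => ρ v (Fin.ofNat _ t)) μ) := by
  obtain ⟨h1, h2, h3⟩ := hruns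
  refine (simulates_aggregate _ hid hg ?_).append ?_ ?_
  · intro v
    have := (ρ v (Fin.ofNat _ t)).1.2
    change (if (μ v).cand = true then ((ρ v (Fin.ofNat _ t)).1 : ℕ) + 1 else 0) ≤ _
    split_ifs <;> omega
  · refine (simulates_shortestPaths (s := sampledIn (fun v => ρ v (Fin.ofNat _ t)) μ)
      _ _ _ (fun v => rfl) (isSome_pathOutput h1)).append ?_ ?_
    · refine (simulates_shortestPaths (s := sampledIn (fun v => ρ v (Fin.ofNat _ t)) μ)
        _ _ _ (fun v => rfl) (isSome_pathOutput h2)).append ?_ ?_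
      · refine (simulates_aggregate _ hid hg ?_).append ?_ ?_
        · intro v
          exact ((min_le_left _ _).trans (hμ v)).trans (by omega)
        · exact simulates_shortestPaths
            (s := (farthest T (fun v => ρ v (Fin.ofNat _ t)) μ).2)
            _ _ _ (fun v => rfl) (isSome_pathOutput h3)
        · exact sticky_shortestPaths _ _ _ _
      · exact (sticky_aggregate _ _ _).append <| sticky_shortestPaths _ _ _ _
    · exact (sticky_shortestPaths _ _ _ _).append <| (sticky_aggregate _ _ _).append <|
        sticky_shortestPaths _ _ _ _
  · exact (sticky_shortestPaths _ _ _ _).append <| (sticky_shortestPaths _ _ _ _).append <|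
      (sticky_aggregate _ _ _).append <| sticky_shortestPaths _ _ _ _

theorem simulates_phases {T g : ℕ} {α : ℝ} {ρ : G.nodes → CoinTape A p}
    (hid : ∀ v ∈ G.nodes, v < p.idBound) (hg : ∀ v w, G.comm.dist v w ≤ 2 * g) (t : ℕ)
    (hruns : ∀ s < t, RunsSucceed T (fun v => ρ v (Fin.ofNat _ s)) (memAfter T ρ s) α) :
    Simulates T g ρ (phases g t) (memAfter T ρ 0) (memAfter T ρ t) := by
  induction t with
  | zero => exact fun _ => rfl
  | succ t ih =>
    have h : (phases g (t + 1) : List (Step (Agent A p) (EccMsg A p))) =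
        phases g t ++ phase g t := by
      simp [phases, List.range_succ, List.flatMap_append]
    rw [h]
    exact (ih fun s hs => hruns s (by omega)).append
      (simulates_phase hid hg (fromC_memAfter_le T ρ t) (hruns t (by omega))) (sticky_phase g t)

theorem simulates_extremes {T g : ℕ} {ρ : G.nodes → CoinTape A p} {μ : G.nodes → Mem}
    (hid : ∀ v ∈ G.nodes, v < p.idBound) (hg : ∀ v w, G.comm.dist v w ≤ 2 * g)
    (hμ : ∀ v, (μ v).fromC ≤ p.top) (hμ' : ∀ v, (μ v).toC ≤ p.top) :
    Simulates T g ρ (extremes g) μ (withExtremes p μ) := by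
  refine (simulates_aggregate _ hid hg fun v => ?_).append
    ((simulates_aggregate _ hid hg fun v => ?_).append
      (simulates_aggregate _ hid hg fun v => ?_) (sticky_aggregate _ _ _))
    ((sticky_aggregate _ _ _).append (sticky_aggregate _ _ _))
  · exact (hμ v).trans (by omega)
  · exact (hμ' v).trans (by omega)
  · exact (Nat.sub_le _ _).trans (by omega)

/-! ### Verification -/

theorem mem_flag_iterate (σ : G.nodes → Agent A p) (t : ℕ) (v : G.nodes) :
    ((flag.run G)^[t] σ v).mem = (σ v).mem := by
  induction t with
  | zero => rfl
  | succ t ih => rw [Function.iterate_succ_apply']; exact ih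

theorem bad_flag_eq_false {σ : G.nodes → Agent A p} {v : G.nodes}
    (h : (flag.run G σ v).bad = false) :
    (σ v).bad = false ∧ ∀ w, G.comm.Adj w v → (σ w).bad = false := by
  classical
  have h' := Bool.or_eq_false_iff.1 h
  refine ⟨h'.1, fun w hw => ?_⟩
  by_contra hc
  refine of_decide_eq_false h'.2 ⟨w, ?_⟩
  refine Option.isSome_iff_exists.2 ⟨.inr 0, Network.gather_eq_some_iff.2 ⟨w, rfl, hw, ?_⟩⟩
  simp [flag, hc]

theorem bad_flag_iterate_eq_false {σ : G.nodes → Agent A p} {t : ℕ} {v w : G.nodes}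
    (h : ((flag.run G)^[t] σ v).bad = false) (hw : G.comm.dist w v ≤ t) :
    (σ w).bad = false := by
  induction t generalizing v with
  | zero =>
    rw [(G.comm_connected.dist_eq_zero_iff).1 (Nat.le_zero.1 hw)]
    exact h
  | succ t ih =>
    rw [Function.iterate_succ_apply'] at h
    obtain ⟨h1, h2⟩ := bad_flag_eq_false h
    rcases hw.lt_or_eq with hw | hw
    · exact ih h1 (Nat.lt_succ_iff.1 hw)
    · obtain ⟨u, hu, hadj⟩ := G.comm_connected.exists_adj_dist hw
      exact ih (h2 u hadj) hu.le

theorem bad_flag_iterate_of_forall {σ : G.nodes → Agent A p} (h : ∀ v, (σ v).bad = false)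
    (t : ℕ) (v : G.nodes) : ((flag.run G)^[t] σ v).bad = false := by
  classical
  induction t generalizing v with
  | zero => exact h v
  | succ t ih =>
    rw [Function.iterate_succ_apply']
    refine Bool.or_eq_false_iff.2 ⟨ih v, decide_eq_false ?_⟩
    rintro ⟨i, hi⟩
    obtain ⟨m, hm⟩ := Option.isSome_iff_exists.1 hi
    obtain ⟨w, -, -, e⟩ := Network.gather_eq_some_iff.1 hm
    change (if ((flag.run G)^[t] σ w).bad then some _ else none) = _ at e
    rw [ih w] at e
    cases e

theorem bad_check_eq_false {σ : G.nodes → Agent A p} {v : G.nodes} :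
    (check.run G σ v).bad = false ↔
      (σ v).bad = false ∧ ∀ w, G.comm.Adj w v → (σ w).reg = (σ v).reg := by
  refine Bool.or_eq_false_iff.trans (and_congr_right fun _ => decide_eq_false_iff_not.trans ?_)
  constructor
  · intro h w hw
    by_contra hc
    exact h ⟨w, _, Network.gather_eq_some_iff.2 ⟨w, rfl, hw, rfl⟩, hc⟩
  · rintro h ⟨i, k, hi, hk⟩
    obtain ⟨w, -, hw, e⟩ := Network.gather_eq_some_iff.1 hi
    exact hk ((Sum.inr.inj (Option.some.inj e)).symm.trans (h w hw))

theorem runList_verify (σ : G.nodes → Agent A p) (g : ℕ) :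
    Step.runList G (verify g) σ = (flag.run G)^[2 * g + 1] (check.run G ((flood.run G)^[g]
      fun v => { σ v with reg := p.key 0 (σ v).view.self })) := by
  rw [verify, Step.runList_cons, Step.runList_append, Step.runList_replicate, Step.silent_run,
    Step.runList_cons, Step.runList_replicate]

theorem mem_verify (σ : G.nodes → Agent A p) (g : ℕ) (v : G.nodes) :
    (Step.runList G (verify g) σ v).mem = (σ v).mem := by
  rw [runList_verify, mem_flag_iterate]
  change ((flood.run G)^[g] _ v).mem = _
  rw [flood_iterate_apply]

/-- Without a flag at `v`, all nodes within distance `2 * g + 1` agree with their neighbours, hence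
hold the key of one node `l`, and lie within `g` of `l`. So they lie within `2 * g` of `v`; nothing
is at distance exactly `2 * g + 1`, and by connectedness nothing is beyond. The ball is then the
whole network. -/
theorem bad_verify_eq_false {σ : G.nodes → Agent A p} {g : ℕ}
    (hid : ∀ v ∈ G.nodes, v < p.idBound) (hself : ∀ v, (σ v).view.self = v) {v : G.nodes}
    (hv : (Step.runList G (verify g) σ v).bad = false) :
    (∀ a b, G.comm.dist a b ≤ 2 * g) ∧ ∀ w, (σ w).bad = false := by
  rw [runList_verify] at hv
  set σ' : G.nodes → Agent A p := fun v => { σ v with reg := p.key 0 (σ v).view.self } with hσ'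
  have hball : ∀ w, G.comm.dist w v ≤ 2 * g + 1 → (σ w).bad = false ∧
      ∀ u, G.comm.Adj u w → ((flood.run G)^[g] σ' u).reg = ((flood.run G)^[g] σ' w).reg := by
    intro w hw
    have h := bad_check_eq_false.1 (bad_flag_iterate_eq_false hv hw)
    rw [flood_iterate_apply] at h
    exact h
  have hkey : ∀ w, (σ' w).reg.val = w.1 := by
    intro w
    change (p.key 0 (σ w).view.self).val = _
    rw [hself, p.key_val (Nat.zero_le _) (hid w w.2), zero_mul, zero_add]
  obtain ⟨l, hl, el⟩ := exists_reg_flood_iterate σ' g v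
  have hreg : ∀ t ≤ 2 * g + 1, ∀ w, G.comm.dist v w = t →
      ((flood.run G)^[g] σ' w).reg = (σ' l).reg := by
    intro t
    induction t with
    | zero =>
      intro _ w hw
      rw [← (G.comm_connected.dist_eq_zero_iff).1 hw, el]
    | succ t ih =>
      intro ht w hw
      obtain ⟨u, hu, hadj⟩ := G.comm_connected.exists_adj_dist hw
      rw [← ih (by omega) u hu]
      exact (hball u (by rw [SimpleGraph.dist_comm]; omega)).2 w hadj.symm
  have hnear : ∀ w, G.comm.dist v w ≤ 2 * g + 1 → G.comm.dist l w ≤ g := by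
    intro w hw
    obtain ⟨l', hl', el'⟩ := exists_reg_flood_iterate σ' g w
    have : l' = l := by
      rw [hreg _ hw w rfl] at el'
      exact Subtype.ext (by rw [← hkey, ← hkey, el'])
    exact this ▸ hl'
  -- This is why the flags travel one round further than `2 * g`: the sphere of radius `2 * g + 1`
  -- must be inspected to be seen empty.
  have hno : ∀ w, G.comm.dist v w ≠ 2 * g + 1 := by
    intro w hw
    have h1 := hnear w hw.le
    have h2 := G.comm_connected.dist_triangle (u := v) (v := l) (w := w)
    rw [SimpleGraph.dist_comm (u := v) (v := l)] at h2
    omega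
  have hfar : ∀ t, ∀ w, G.comm.dist v w ≠ 2 * g + 1 + t := by
    intro t
    induction t with
    | zero => exact hno
    | succ t ih =>
      intro w hw
      obtain ⟨u, hu, -⟩ := G.comm_connected.exists_adj_dist (t := 2 * g + 1 + t) hw
      exact ih u hu
  have hall : ∀ w, G.comm.dist v w ≤ 2 * g + 1 := by
    intro w
    by_contra! hc
    exact hfar (G.comm.dist v w - (2 * g + 1)) w (by omega)
  refine ⟨fun a b => ?_, fun w => (hball w (by rw [SimpleGraph.dist_comm]; exact hall w)).1⟩
  have h1 := hnear a (hall a)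
  have h2 := hnear b (hall b)
  have h3 := G.comm_connected.dist_triangle (u := a) (v := l) (w := b)
  rw [SimpleGraph.dist_comm (u := a) (v := l)] at h3
  omega

theorem bad_verify_of_forall {σ : G.nodes → Agent A p} {g : ℕ}
    (hσ : ∀ v, (σ v).bad = false) (hg : ∀ a b, G.comm.dist a b ≤ g) (v : G.nodes) :
    (Step.runList G (verify g) σ v).bad = false := by
  rw [runList_verify]
  refine bad_flag_iterate_of_forall (fun w => bad_check_eq_false.2 ⟨?_, fun u _ => ?_⟩) _ _
  · rw [flood_iterate_apply]
    exact hσ w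
  · set σ' : G.nodes → Agent A p := fun v => { σ v with reg := p.key 0 (σ v).view.self }
    have : ∀ a b : G.nodes, ((flood.run G)^[g] σ' a).reg ≤ ((flood.run G)^[g] σ' b).reg := by
      intro a b
      obtain ⟨l, -, e⟩ := exists_reg_flood_iterate σ' g a
      rw [e]
      exact le_reg_flood_iterate σ' g (hg l b)
    exact le_antisymm (this u w) (this w u)

/-! ### The result of the program -/

theorem view_runList {l : List (Step (Agent A p) (EccMsg A p))}
    (hl : ∀ q ∈ l, ∀ s inbox, (q.recv s inbox).view = s.view) (σ : G.nodes → Agent A p)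
    (v : G.nodes) : (Step.runList G l σ v).view = (σ v).view := by
  induction l generalizing σ with
  | nil => rfl
  | cons q l ih =>
    exact (ih (fun q' hq' => hl q' (List.mem_cons_of_mem _ hq')) _).trans
      (hl q List.mem_cons_self _ _)

theorem view_aggregate (x : Agent A p → ℕ) (store : ℕ → Mem → ℕ → ℕ → Mem) (g : ℕ) :
    ∀ q ∈ aggregate x store g, ∀ s inbox, (q.recv s inbox).view = s.view := by
  intro q hq s inbox
  simp only [aggregate, List.mem_cons, List.mem_append, List.not_mem_nil, or_false] at hq
  rcases hq with rfl | hq | rfl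
  · rfl
  · rw [List.eq_of_mem_replicate hq]
    rfl
  · rfl

theorem view_shortestPaths (b : Bool) (tape : CoinTape A p → A.Tape) (store : Mem → ℕ → Mem)
    (g : ℕ) : ∀ q ∈ shortestPaths b tape store g, ∀ s inbox,
      (q.recv s inbox).view = s.view := by
  intro q hq s inbox
  simp only [shortestPaths, List.mem_cons, List.mem_append, List.not_mem_nil, or_false] at hq
  rcases hq with rfl | hq | rfl
  · rfl
  · rw [List.eq_of_mem_replicate hq]
    rfl
  · simp only [Step.silent]
    split <;> rfl

theorem view_main (g t : ℕ) : ∀ q ∈ (phases g t ++ extremes g : List (Step (Agent A p) _)),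
    ∀ s inbox, (q.recv s inbox).view = s.view := by
  intro q hq
  simp only [phases, phase, extremes, List.mem_append, List.mem_flatMap] at hq
  rcases hq with ⟨_, -, hq | hq | hq | hq | hq⟩ | hq | hq | hq
  all_goals first
    | exact view_aggregate _ _ _ q hq
    | exact view_shortestPaths _ _ _ _ q hq

variable {T g : ℕ} {α : ℝ} {ρ : G.nodes → CoinTape A p}

theorem simulates_main (hid : ∀ v ∈ G.nodes, v < p.idBound)
    (hruns : ∀ s < p.phases, RunsSucceed T (fun v => ρ v (Fin.ofNat _ s)) (memAfter T ρ s) α)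
    (hg : ∀ v w, G.comm.dist v w ≤ 2 * g) :
    Simulates T g ρ (phases g p.phases ++ extremes g) (memAfter T ρ 0)
      (withExtremes p (memAfter T ρ p.phases)) :=
  (simulates_phases hid hg _ hruns).append
    (simulates_extremes hid hg (fromC_memAfter_le _ _ _) (toC_memAfter_le _ _ _))
    (sticky_extremes g)

/-- Soundness for every guess, even one smaller than `T` or than the hop diameter: acceptance
implies both that aggregation was complete and that no simulated run was cut off before its outputs.
-/
theorem result_program (hid : ∀ v ∈ G.nodes, v < p.idBound)
    (hruns : ∀ s < p.phases, RunsSucceed T (fun v => ρ v (Fin.ofNat _ s)) (memAfter T ρ s) α)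
    {v : G.nodes} {o : EccOutput}
    (h : result (Step.runList G (program g) (fun v : G.nodes => start (G.view v) (ρ v)) v) =
      some o) :
    o = outputOf p (withExtremes p (memAfter T ρ p.phases) v) := by
  change result (Step.runList G (program g) (idle ρ (memAfter T ρ 0)) v) = some o at h
  rw [program, Step.runList_append] at h
  unfold result at h
  split_ifs at h with hb
  have hb' := bad_verify_eq_false hid (fun w => by
    rw [view_runList (view_main g p.phases)]; rfl) (Bool.eq_false_iff.2 hb)
  have hsim := simulates_main hid hruns hb'.1 (.inr hb'.2)
  rw [mem_verify, hsim] at h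
  exact (Option.some.inj h).symm

theorem isSome_result_program (hid : ∀ v ∈ G.nodes, v < p.idBound)
    (hruns : ∀ s < p.phases, RunsSucceed T (fun v => ρ v (Fin.ofNat _ s)) (memAfter T ρ s) α)
    (hT : T ≤ g) (hg : ∀ a b, G.comm.dist a b ≤ g) (v : G.nodes) :
    (result (Step.runList G (program g)
      (fun v : G.nodes => start (G.view v) (ρ v)) v)).isSome := by
  change (result (Step.runList G (program g) (idle ρ (memAfter T ρ 0)) v)).isSome
  rw [program, Step.runList_append,
    simulates_main hid hruns (fun a b => (hg a b).trans (by omega)) (.inl hT)]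
  simp [result, bad_verify_of_forall (σ := idle ρ _) (fun _ => rfl) hg v]

/-- If all runs of the shortest path algorithm succeed, then the eccentricity algorithm terminates
with the output determined by the memories after the last phase. -/
theorem output_eccAlgorithm (hid : ∀ v ∈ G.nodes, v < p.idBound)
    (hruns : ∀ s < p.phases, RunsSucceed T (fun v => ρ v (Fin.ofNat _ s)) (memAfter T ρ s) α)
    {R : ℕ} (hpos : 0 < G.hopDiam) (hR : (68 * p.phases + 76) * (T + G.hopDiam) ≤ R)
    (v : G.nodes) :
    (eccAlgorithm A p).output ((eccAlgorithm A p).config G () ρ R v) =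
      some (outputOf p (withExtremes p (memAfter T ρ p.phases) v)) := by
  -- The first guess that is certainly large enough, at most twice `T + D` (for `i = 0` because `D >
  -- 0`). All guesses up to it cost at most `(17 * p.phases + 19) * 2 ^ (i + 1)`, whence the factor
  -- 4 · 17 = 68 and 4 · 19 = 76.
  set i := Nat.clog 2 (T + G.hopDiam) with hi
  have hle : T + G.hopDiam ≤ 2 ^ i := Nat.le_pow_clog one_lt_two _
  have hlt : 2 ^ i ≤ 2 * (T + G.hopDiam) := by
    rcases Nat.eq_zero_or_pos i with h0 | h0
    · rw [h0]
      omega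
    · have := Nat.pow_pred_clog_lt_self (b := 2) one_lt_two (x := T + G.hopDiam)
        (by by_contra! hc; rw [hi, Nat.clog_of_right_le_one hc] at h0; omega)
      rw [← hi] at this
      calc 2 ^ i = 2 * 2 ^ i.pred := by
            rw [← pow_succ', ← Nat.succ_eq_add_one, Nat.succ_pred_eq_of_pos h0]
        _ ≤ _ := by omega
  refine Step.repeatUntil_output (Tape := CoinTape A p) _ _ _ ρ
    (f := fun v => outputOf p (withExtremes p (memAfter T ρ p.phases) v)) (i := i)
    (fun i v o h => result_program hid hruns h) (fun v => isSome_result_program hid hruns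
      (by omega) (fun a b => (G.comm_dist_le_hopDiam a b).trans (by omega)) v) ?_ v
  refine (Step.elapsed_le _ (fun j => length_program_le Nat.one_le_two_pow) (i + 1)).trans ?_
  refine le_trans ?_ hR
  rw [pow_succ]
  calc (17 * p.phases + 19) * (2 ^ i * 2)
      ≤ (17 * p.phases + 19) * (2 * (T + G.hopDiam) * 2) := by gcongr
    _ = _ := by ring

end Agent

/-! ### Correctness of the computation -/

theorem unquantize_mono (B : ℕ) : Monotone (unquantize B) := by
  intro x y h
  unfold unquantize
  split_ifs
  · exact_mod_cast h
  · exact le_top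
  · omega
  · exact le_rfl

/-- The true distance is an integer below `B` or infinite. Rounding down and capping at `B - 1`
therefore keep the estimate above it, and only decrease a finite estimate. -/
theorem IsApprox.unquantize_quantize {B : ℕ} {α : ℝ} {d : ℕ∞} {e : ℝ≥0∞} (h : IsApprox α d e)
    (hd : d = ⊤ ∨ d < B) : IsApprox α d (unquantize B (quantize B e)) := by
  by_cases he : e = ⊤
  · have : unquantize B (quantize B e) = e := by simp [quantize, unquantize, he]
    rwa [this]
  have hdt : d ≠ ⊤ := by
    rintro rfl
    exact he (by simpa using h.1)
  obtain ⟨k, rfl⟩ := ENat.ne_top_iff_exists.1 hdt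
  have hk : k < B := by
    rcases hd with hd | hd
    · exact absurd hd hdt
    · exact_mod_cast hd
  have hlt : min ⌊e.toReal⌋₊ (B - 1) < B := by omega
  have hke : (k : ℝ≥0∞) ≤ e := by simpa using h.1
  have hkf : k ≤ ⌊e.toReal⌋₊ := by
    refine Nat.le_floor ?_
    have := ENNReal.toReal_mono he hke
    simpa using this
  simp only [quantize, unquantize, he, if_false, hlt, if_true]
  constructor
  · have : k ≤ min ⌊e.toReal⌋₊ (B - 1) := by omega
    rw [ENat.toENNReal_coe]
    exact_mod_cast this
  · refine le_trans ?_ h.2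
    calc ((min ⌊e.toReal⌋₊ (B - 1) : ℕ) : ℝ≥0∞) ≤ (⌊e.toReal⌋₊ : ℕ) := by
          exact_mod_cast min_le_left _ _
      _ = ENNReal.ofReal (⌊e.toReal⌋₊ : ℕ) := (ENNReal.ofReal_natCast _).symm
      _ ≤ ENNReal.ofReal e.toReal :=
          ENNReal.ofReal_le_ofReal (Nat.floor_le ENNReal.toReal_nonneg)
      _ = e := ENNReal.ofReal_toReal he

namespace Network

variable {G : Network}

theorem exists_ecc_eq (v : ℕ) : ∃ u : G.nodes, G.ecc v = G.dist v u := by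
  have hne : G.nodes.Nonempty := Finset.nonempty_coe_sort.1 G.comm_connected.nonempty
  obtain ⟨u, hu, h⟩ := Finset.exists_mem_eq_sup G.nodes hne (G.dist v)
  exact ⟨⟨u, hu⟩, by rw [← h, Finset.sup_eq_iSup]; rfl⟩

theorem exists_diameter_eq : ∃ v : G.nodes, G.diameter = G.ecc v := by
  have hne : G.nodes.Nonempty := Finset.nonempty_coe_sort.1 G.comm_connected.nonempty
  obtain ⟨u, hu, h⟩ := Finset.exists_mem_eq_sup G.nodes hne G.ecc
  exact ⟨⟨u, hu⟩, by rw [← h, Finset.sup_eq_iSup]; rfl⟩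

theorem exists_radius_eq : ∃ v : G.nodes, G.radius = G.ecc v := by
  have hne : G.nodes.Nonempty := Finset.nonempty_coe_sort.1 G.comm_connected.nonempty
  obtain ⟨u, hu, h⟩ := Finset.exists_mem_eq_inf G.nodes hne G.ecc
  exact ⟨⟨u, hu⟩, by rw [← h, Finset.inf_eq_iInf]; rfl⟩

theorem ecc_le_diameter (v : G.nodes) : G.ecc v ≤ G.diameter :=
  le_iSup₂ (f := fun v (_ : v ∈ G.nodes) => G.ecc v) v.1 v.2

theorem radius_le_ecc (v : G.nodes) : G.radius ≤ G.ecc v :=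
  iInf₂_le (f := fun v (_ : v ∈ G.nodes) => G.ecc v) v.1 v.2

end Network

namespace Agent

variable {A : CongestAlgorithm ℕ ℝ≥0∞} {p : Params} {G : Network} {T : ℕ} {ε : ℝ}

theorem isApprox_estimate (htop : ∀ u v, G.dist u v = ⊤ ∨ G.dist u v < p.top) {b : Bool} {s : ℕ}
    {r : G.nodes → A.Tape} {α : ℝ}
    (h : A.SucceedsWithin (G.orient b) s T (SSSPSpec (G.orient b) α s) r) (v : G.nodes) :
    IsApprox α ((G.orient b).dist s v) (unquantize p.top (estimate p A G T b s r v)) := by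
  obtain ⟨f, hf, hspec⟩ := h
  have e : pathOutput A G b s r T v = some (f v) := hf v
  rw [estimate, e, Option.getD_some]
  refine (hspec v).unquantize_quantize ?_
  cases b
  · exact htop s v
  · rw [Network.dist_orient_true]
    exact htop v s

theorem isApprox_estimate_true (htop : ∀ u v, G.dist u v = ⊤ ∨ G.dist u v < p.top) {s : ℕ}
    {r : G.nodes → A.Tape} {α : ℝ}
    (h : A.SucceedsWithin (G.orient true) s T (SSSPSpec (G.orient true) α s) r) (v : G.nodes) :
    IsApprox α (G.dist v s) (unquantize p.top (estimate p A G T true s r v)) := by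
  rw [← Network.dist_orient_true]
  exact isApprox_estimate htop h v

/-- The properties of the memories that all phases maintain, where `a` is the approximation ratio of
the shortest path algorithm. -/
structure Invariant (p : Params) (G : Network) (a : ℝ≥0∞) (μ : G.nodes → Mem) : Prop where
  le_from : ∀ u : G.nodes, unquantize p.top (μ u).fromC = ⊤ ∨
    ∃ c : G.nodes, (μ c).center = true ∧ (G.dist c u : ℝ≥0∞) ≤ unquantize p.top (μ u).fromC
  from_le : ∀ c u : G.nodes, (μ c).center = true →
    unquantize p.top (μ u).fromC ≤ a * (G.dist c u : ℝ≥0∞)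
  le_to : ∀ c v : G.nodes, (μ c).center = true → (G.dist v c : ℝ≥0∞) ≤ unquantize p.top (μ v).toC
  to_le : ∀ v : G.nodes, unquantize p.top (μ v).toC ≤ a * (G.ecc v : ℝ≥0∞)
  -- Imposed on discarded nodes only; later phases preserve it because `fromC` never increases.
  from_le_ecc : ∀ v u : G.nodes, (μ v).cand = false →
    unquantize p.top (μ u).fromC ≤ a ^ 2 * (G.ecc v : ℝ≥0∞)

theorem invariant_zero (htop : 0 < p.top) (a : ℝ≥0∞) (ρ : G.nodes → CoinTape A p) :
    Invariant p G a (memAfter T ρ 0) where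
  le_from _ := .inl (by simp [memAfter, unquantize])
  from_le _ _ h := by cases h
  le_to _ _ h := by cases h
  to_le _ := by simp [memAfter, unquantize, htop]
  from_le_ecc _ _ h := by cases h

section phase

variable {ω : G.nodes → Coins A p} {μ : G.nodes → Mem}

theorem exists_sampledIn_eq (hid : ∀ v ∈ G.nodes, v < p.idBound) :
    ∃ c : G.nodes, sampledIn ω μ = c := by
  obtain ⟨c, hc, -⟩ := Network.leader_spec hid fun v => if (μ v).cand then ((ω v).1 : ℕ) + 1 else 0
  exact ⟨c, congrArg Prod.snd hc⟩

theorem exists_farthest_eq (hid : ∀ v ∈ G.nodes, v < p.idBound) :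
    ∃ u : G.nodes, farthest T ω μ = (fromAfter T ω μ u, u.1) ∧
      ∀ v, fromAfter T ω μ v ≤ fromAfter T ω μ u :=
  Network.leader_spec hid _

theorem center_phaseStep (v : G.nodes) :
    (phaseStep T ω μ v).center = true ↔ (μ v).center = true ∨ v.1 = sampledIn ω μ := by
  simp [phaseStep, Mem.discard]

theorem cand_phaseStep (v : G.nodes) :
    (phaseStep T ω μ v).cand = true ↔ (μ v).cand = true ∧
      ¬ unquantize p.top (farthest T ω μ).1 ≤ p.ratio * unquantize p.top
        (estimate p A G T true (farthest T ω μ).2 (fun w => (ω w).2.2.2) v) := by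
  simp [phaseStep, Mem.discard]

theorem fromC_phaseStep (v : G.nodes) : (phaseStep T ω μ v).fromC = fromAfter T ω μ v := rfl

theorem toC_phaseStep (v : G.nodes) : (phaseStep T ω μ v).toC = toAfter T ω μ v := rfl

variable (hid : ∀ v ∈ G.nodes, v < p.idBound) (hratio : p.ratio = ENNReal.ofReal (1 + ε))
  (htop : ∀ u v, G.dist u v = ⊤ ∨ G.dist u v < p.top) (hruns : RunsSucceed T ω μ (1 + ε))
  (hμ : Invariant p G p.ratio μ)

include hratio htop hruns hμ in
theorem fromAfter_le {c : G.nodes} (hc : (phaseStep T ω μ c).center = true) (u : G.nodes) :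
    unquantize p.top (fromAfter T ω μ u) ≤ p.ratio * (G.dist c u : ℝ≥0∞) := by
  rcases (center_phaseStep c).1 hc with hc | hc
  · exact (unquantize_mono _ (min_le_left _ _)).trans (hμ.from_le c u hc)
  · refine (unquantize_mono _ (min_le_right _ _)).trans ?_
    rw [hratio, hc]
    exact (isApprox_estimate htop hruns.1 u).2

include hid hratio htop hruns hμ in
theorem invariant_phaseStep : Invariant p G p.ratio (phaseStep T ω μ) := by
  obtain ⟨c, hc⟩ := exists_sampledIn_eq (ω := ω) (μ := μ) hid
  obtain ⟨f, hf, hmax⟩ := exists_farthest_eq (T := T) (ω := ω) (μ := μ) hid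
  have hcc : (phaseStep T ω μ c).center = true := (center_phaseStep c).2 (.inr hc.symm)
  refine ⟨fun u => ?_, fun c' u hc' => fromAfter_le hratio htop hruns hμ hc' u,
    fun c' v hc' => ?_, fun v => ?_, fun v u hv => ?_⟩
  · rw [fromC_phaseStep, fromAfter]
    rcases min_choice (μ u).fromC
      (estimate p A G T false (sampledIn ω μ) (fun w => (ω w).2.1) u) with h | h
    · rw [h]
      exact (hμ.le_from u).imp_right fun ⟨c', hc', h'⟩ =>
        ⟨c', (center_phaseStep c').2 (.inl hc'), h'⟩
    · rw [h]
      refine .inr ⟨c, hcc, ?_⟩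
      rw [← hc]
      exact (isApprox_estimate htop hruns.1 u).1
  · rcases (center_phaseStep c').1 hc' with hc' | hc'
    · exact (hμ.le_to c' v hc').trans (unquantize_mono _ (le_max_left _ _))
    · refine le_trans ?_ (unquantize_mono _ (le_max_right _ _))
      rw [hc']
      exact (isApprox_estimate_true htop hruns.2.1 v).1
  · rw [toC_phaseStep, toAfter, (unquantize_mono p.top).map_max]
    refine max_le (hμ.to_le v) ((isApprox_estimate_true htop hruns.2.1 v).2.trans ?_)
    rw [hratio, hc]
    gcongr
    exact G.dist_le_ecc _ c.2
  · rw [fromC_phaseStep]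
    by_cases hv' : (μ v).cand = false
    · exact (unquantize_mono _ (min_le_left _ _)).trans (hμ.from_le_ecc v u hv')
    -- Here `v` is discarded in the present phase: from(u) ≤ from(f) ≤ a·est(v,f) ≤ a²·d(v,f) ≤
    -- a²·ecc(v), with `f` the farthest node.
    · have hle := not_not.1 fun h => (Bool.eq_false_iff.1 hv)
        ((cand_phaseStep v).2 ⟨by simpa using hv', h⟩)
      have hest := (isApprox_estimate_true htop hruns.2.2 v).2
      rw [hf, ← hratio] at hest
      rw [hf] at hle
      refine (unquantize_mono _ (hmax u)).trans (hle.trans ?_)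
      rw [sq, mul_assoc]
      gcongr
      refine hest.trans ?_
      gcongr
      exact G.dist_le_ecc _ f.2

include hid hratio htop hruns hμ in
/-- A remaining candidate is closer to the selected node than the pseudo-center is. -/
theorem dist_lt_of_cand_phaseStep {v : G.nodes} (hv : (phaseStep T ω μ v).cand = true) :
    ∀ c, (phaseStep T ω μ c).center = true →
      G.dist v (farthest T ω μ).2 < G.dist c (farthest T ω μ).2 := by
  intro c hc
  obtain ⟨f, hf, -⟩ := exists_farthest_eq (T := T) (ω := ω) (μ := μ) hid
  by_contra! hle
  -- Otherwise from(f) ≤ a·d(c,f) ≤ a·d(v,f) ≤ a·est(v,f), which is the criterion for discarding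
  -- `v`.
  refine ((cand_phaseStep v).1 hv).2 ?_
  have hest := (isApprox_estimate_true htop hruns.2.2 v).1
  refine le_trans (le_trans ?_ (mul_le_mul_right (ENat.toENNReal_le.2 hle) p.ratio))
    (mul_le_mul_right hest p.ratio)
  rw [hf]
  exact fromAfter_le hratio htop hruns hμ hc f

end phase

theorem invariant_memAfter {ρ : G.nodes → CoinTape A p} (hid : ∀ v ∈ G.nodes, v < p.idBound)
    (hratio : p.ratio = ENNReal.ofReal (1 + ε)) (hpos : 0 < p.top)
    (htop : ∀ u v, G.dist u v = ⊤ ∨ G.dist u v < p.top) (t : ℕ)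
    (hruns : ∀ s < t, RunsSucceed T (fun v => ρ v (Fin.ofNat _ s)) (memAfter T ρ s) (1 + ε)) :
    Invariant p G p.ratio (memAfter T ρ t) := by
  induction t with
  | zero => exact invariant_zero hpos _ ρ
  | succ t ih =>
    exact invariant_phaseStep hid hratio htop (hruns t (by omega))
      (ih fun s hs => hruns s (by omega))

theorem card_center_memAfter_le (ρ : G.nodes → CoinTape A p) (t : ℕ) :
    (Finset.univ.filter fun v => (memAfter T ρ t v).center = true).card ≤ t := by
  induction t with
  | zero => simp [memAfter]
  | succ t ih =>
    set c := sampledIn (fun v => ρ v (Fin.ofNat _ t)) (memAfter T ρ t) with hc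
    have hsub : (Finset.univ.filter fun v => (memAfter T ρ (t + 1) v).center = true) ⊆
        (Finset.univ.filter fun v => (memAfter T ρ t v).center = true) ∪
          Finset.univ.filter fun v : G.nodes => v.1 = c := by
      intro v hv
      simp only [Finset.mem_union, Finset.mem_filter, Finset.mem_univ, true_and] at hv ⊢
      exact (center_phaseStep v).1 hv
    have hone : (Finset.univ.filter fun v : G.nodes => v.1 = c).card ≤ 1 := by
      refine Finset.card_le_one.2 fun v hv w hw => Subtype.ext ?_
      rw [(Finset.mem_filter.1 hv).2, (Finset.mem_filter.1 hw).2]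
    exact (Finset.card_le_card hsub).trans ((Finset.card_union_le _ _).trans (add_le_add ih hone))

/-- If no candidates are left, then the outputs are correct. -/
theorem eccSpec_of_invariant {μ : G.nodes → Mem} {m : ℕ} (hid : ∀ v ∈ G.nodes, v < p.idBound)
    (hε : 0 ≤ ε) (hratio : p.ratio = ENNReal.ofReal (1 + ε)) (hμ : Invariant p G p.ratio μ)
    (hto : ∀ v, (μ v).toC ≤ p.top) (hcand : ∀ v, (μ v).cand = false)
    (hcard : (Finset.univ.filter fun v => (μ v).center = true).card ≤ m) :
    EccSpec G (2 + ε ^ 3 + 3 * ε ^ 2 + 4 * ε) ((1 + ε) ^ 2) m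
      (fun v => outputOf p (withExtremes p μ v)) := by
  set α : ℝ := 2 + ε ^ 3 + 3 * ε ^ 2 + 4 * ε with hα
  have hone : 1 ≤ p.ratio := by
    rw [hratio, ENNReal.one_le_ofReal]
    linarith
  -- The claimed ratio is (1 + ε) + (1 + ε)³.
  have hαr : ENNReal.ofReal α = p.ratio + p.ratio ^ 3 := by
    rw [hratio, ← ENNReal.ofReal_pow (by linarith), ← ENNReal.ofReal_add (by linarith)
      (by positivity), hα]
    congr 1
    ring
  obtain ⟨f, hf, hfmax⟩ := Network.leader_spec hid fun w => (μ w).fromC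
  obtain ⟨h, hh, hhmax⟩ := Network.leader_spec hid fun w => (μ w).toC
  obtain ⟨l, hl, hlmax⟩ := Network.leader_spec hid fun w => p.top - (μ w).toC
  set est : G.nodes → ℝ≥0∞ := fun v =>
    unquantize p.top (μ v).toC + unquantize p.top (μ f).fromC with hest
  have hecc : ∀ v : G.nodes, IsApprox α (G.ecc v) (est v) := by
    intro v
    constructor
    · obtain ⟨u, hu⟩ := G.exists_ecc_eq v
      rw [hu, hest]
      have hfu := unquantize_mono p.top (hfmax u)
      -- The path from `v` to its farthest node `u` is compared with a detour through a center node
      -- `c` that accounts for the estimate at `u`. All center nodes are covered by `toC`, a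
      -- maximum.
      rcases hμ.le_from u with hu' | ⟨c, hc, hcu⟩
      · rw [hu', top_le_iff] at hfu
        simp [hfu]
      · refine (ENat.toENNReal_le.2 (G.dist_triangle v c u)).trans ?_
        rw [ENat.toENNReal_add]
        exact add_le_add (hμ.le_to c v hc) (hcu.trans hfu)
    -- The argument gives the ratio a + a²; it is weakened to a + a³, using a ≥ 1.
    · rw [hαr, add_mul]
      refine add_le_add (hμ.to_le v) ((hμ.from_le_ecc v f (hcand v)).trans ?_)
      gcongr
      norm_num
  have hle : ∀ v : G.nodes, est v ≤ est h := fun v =>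
    add_le_add_left (unquantize_mono _ (hhmax v)) _
  have hge : ∀ v : G.nodes, est l ≤ est v := by
    intro v
    refine add_le_add_left (unquantize_mono _ ?_) _
    have := hlmax v
    have := hto v
    have := hto l
    omega
  have hcenter : ∀ c : ℕ, c ∈ centerOf G (fun v => outputOf p (withExtremes p μ v)) ↔
      ∃ v : G.nodes, (μ v).center = true ∧ v.1 = c := by
    intro c
    refine Finset.mem_image.trans (exists_congr fun v => and_congr_left fun _ => ?_)
    exact Finset.mem_filter.trans (and_iff_right (Finset.mem_attach _ v))
  refine ⟨fun v => ⟨?_, ?_, ?_⟩, ⟨?_, fun v hv => ?_⟩, ?_⟩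
  · have : (outputOf p (withExtremes p μ v)).ecc = est v := by
      simp only [outputOf, withExtremes, hf, hest]
    rw [this]
    exact hecc v
  · have : (outputOf p (withExtremes p μ v)).radius = est l := by
      simp only [outputOf, withExtremes, hf, hl, hest, Nat.sub_sub_self (hto l)]
    rw [this]
    obtain ⟨w, hw⟩ := G.exists_radius_eq
    refine ⟨(ENat.toENNReal_le.2 (G.radius_le_ecc l)).trans (hecc l).1, ?_⟩
    rw [hw]
    exact (hge w).trans (hecc w).2
  · have : (outputOf p (withExtremes p μ v)).diameter = est h := by
      simp only [outputOf, withExtremes, hf, hh, hest]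
    rw [this]
    obtain ⟨w, hw⟩ := G.exists_diameter_eq
    constructor
    · rw [hw]
      exact (hecc w).1.trans (hle w)
    · refine (hecc h).2.trans ?_
      gcongr
      exact G.ecc_le_diameter h
  · intro c hc
    obtain ⟨w, -, rfl⟩ := (hcenter c).1 hc
    exact w.2
  · have hβ : ENNReal.ofReal ((1 + ε) ^ 2) = p.ratio ^ 2 := by
      rw [hratio, ENNReal.ofReal_pow (by linarith)]
    rw [hβ]
    refine iSup₂_le fun u hu => ?_
    have hle' := hμ.from_le_ecc ⟨v, hv⟩ ⟨u, hu⟩ (hcand _)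
    rcases hμ.le_from ⟨u, hu⟩ with htop | ⟨c, hc, hcu⟩
    · rw [htop, top_le_iff] at hle'
      have : (G.ecc v : ℝ≥0∞) = ⊤ := by
        by_contra hne
        exact ENNReal.mul_ne_top (ENNReal.pow_ne_top (by rw [hratio]; exact ENNReal.ofReal_ne_top))
          hne hle'
      rw [this]
      exact le_top
    · refine (iInf₂_le c.1 ((hcenter c).2 ⟨c, hc, rfl⟩)).trans (ENNReal.div_le_of_le_mul ?_)
      rw [mul_comm]
      exact hcu.trans hle'
  · refine le_trans ?_ hcard
    refine Finset.card_image_le.trans (le_of_eq ?_)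
    rfl

end Agent

/-! ### Uniform probabilities on finite types -/

section prob

variable {Ω X ι : Type*} [Fintype Ω] [Fintype X]

/-- The probability of an event under the uniform distribution on a finite type. -/
def prob (P : Ω → Prop) : ℝ := by
  classical
  exact ((Finset.univ.filter P).card : ℝ) / (Fintype.card Ω : ℝ)

theorem prob_eq (P : Ω → Prop) [DecidablePred P] :
    prob P = ((Finset.univ.filter P).card : ℝ) / (Fintype.card Ω : ℝ) := by
  unfold prob
  congr!

theorem prob_nonneg (P : Ω → Prop) : 0 ≤ prob P := by
  unfold prob
  positivity

theorem prob_mono {P Q : Ω → Prop} (h : ∀ ω, P ω → Q ω) : prob P ≤ prob Q := by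
  classical
  refine div_le_div_of_nonneg_right ?_ (Nat.cast_nonneg _)
  exact_mod_cast Finset.card_le_card (Finset.monotone_filter_right _ fun ω _ => h ω)

theorem prob_false : prob (fun _ : Ω => False) = 0 := by
  simp [prob]

theorem prob_true [Nonempty Ω] : prob (fun _ : Ω => True) = 1 := by
  simp [prob]

theorem prob_le_one [Nonempty Ω] (P : Ω → Prop) : prob P ≤ 1 :=
  (prob_mono fun _ _ => trivial).trans_eq prob_true

theorem prob_or_le (P Q : Ω → Prop) : prob (fun ω => P ω ∨ Q ω) ≤ prob P + prob Q := by
  classical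
  rw [prob_eq, prob_eq, prob_eq, ← add_div, Finset.filter_or]
  refine div_le_div_of_nonneg_right ?_ (Nat.cast_nonneg _)
  exact_mod_cast Finset.card_union_le _ _

theorem prob_exists_mem_le (s : Finset ι) (P : ι → Ω → Prop) :
    prob (fun ω => ∃ i ∈ s, P i ω) ≤ ∑ i ∈ s, prob (P i) := by
  classical
  induction s using Finset.induction_on with
  | empty => simp [prob_false]
  | insert i s hi ih =>
    rw [Finset.sum_insert hi]
    refine le_trans (prob_mono ?_) ((prob_or_le _ _).trans (add_le_add_right ih _))
    rintro ω ⟨j, hj, h⟩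
    rcases Finset.mem_insert.1 hj with rfl | hj
    · exact .inl h
    · exact .inr ⟨j, hj, h⟩

theorem prob_not [Nonempty Ω] (P : Ω → Prop) : prob (fun ω => ¬ P ω) = 1 - prob P := by
  classical
  rw [prob_eq, prob_eq]
  have hpos : (Fintype.card Ω : ℝ) ≠ 0 := by
    exact_mod_cast Fintype.card_ne_zero
  have := Finset.card_filter_add_card_filter_not (s := (Finset.univ : Finset Ω)) P
  rw [eq_sub_iff_add_eq, ← add_div, div_eq_one_iff_eq hpos, ← Finset.card_univ, add_comm]
  exact_mod_cast this

theorem prob_equiv (e : Ω ≃ Ω) (P : Ω → Prop) : prob (fun ω => P (e ω)) = prob P := by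
  classical
  unfold prob
  congr 2
  exact Finset.card_equiv e (by simp)

theorem sum_prob_le_one (s : Finset ι) (P : ι → Ω → Prop)
    (h : ∀ ω, ∀ i ∈ s, ∀ j ∈ s, P i ω → P j ω → i = j) : ∑ i ∈ s, prob (P i) ≤ 1 := by
  classical
  unfold prob
  rw [← Finset.sum_div]
  refine div_le_one_of_le₀ ?_ (Nat.cast_nonneg _)
  norm_cast
  simp only [Finset.card_filter]
  rw [Finset.sum_comm, ← Finset.card_univ, Finset.card_eq_sum_ones]
  refine Finset.sum_le_sum fun ω _ => ?_
  rw [← Finset.card_filter]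
  refine Finset.card_le_one.2 fun i hi j hj => ?_
  rw [Finset.mem_filter] at hi hj
  exact h ω i hi.1 j hj.1 hi.2 hj.2

/-- If the component `get ω` of `ω` can be changed by `put`, then probabilities can be estimated for
fixed values of all other components. -/
theorem prob_le_of_fibers [Nonempty X] (get : Ω → X) (put : Ω → X → Ω)
    (get_put : ∀ ω x, get (put ω x) = x) (put_put_get : ∀ ω x, put (put ω x) (get ω) = ω)
    {P Q : Ω → Prop} {q : ℝ}
    (h : ∀ ω, prob (fun x => Q (put ω x)) ≤ q * prob fun x => P (put ω x)) :
    prob Q ≤ q * prob P := by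
  classical
  have hX : (Fintype.card X : ℝ) ≠ 0 := by
    exact_mod_cast Fintype.card_ne_zero
  have key : ∀ R : Ω → Prop,
      ∑ ω, prob (fun x => R (put ω x)) = ((Finset.univ.filter R).card : ℝ) := by
    intro R
    unfold prob
    rw [← Finset.sum_div, div_eq_iff hX]
    norm_cast
    simp only [Finset.card_filter]
    rw [← Finset.sum_product', Finset.univ_product_univ]
    -- Exchanging the component of `ω` with `x` permutes the pairs `(ω, x)`. Thus averaging over a
    -- resampled component does not change the count.
    have hinv : Function.Involutive fun z : Ω × X => (put z.1 z.2, get z.1) := by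
      rintro ⟨ω, x⟩
      simp [get_put, put_put_get]
    have := Equiv.sum_comp hinv.toPerm fun z : Ω × X => if R z.1 then 1 else 0
    refine Eq.trans this ?_
    rw [← Finset.univ_product_univ, Finset.sum_product, Finset.sum_mul]
    refine Finset.sum_congr rfl fun ω _ => ?_
    by_cases hω : R ω <;> simp [hω]
  have hsum := Finset.sum_le_sum fun ω (_ : ω ∈ Finset.univ) => h ω
  rw [← Finset.mul_sum, key, key] at hsum
  unfold prob
  rw [← mul_div_assoc]
  exact div_le_div_of_nonneg_right hsum (Nat.cast_nonneg _)

theorem prob_le_of_fibers_le [Nonempty X] [Nonempty Ω] (get : Ω → X) (put : Ω → X → Ω)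
    (get_put : ∀ ω x, get (put ω x) = x) (put_put_get : ∀ ω x, put (put ω x) (get ω) = ω)
    {Q : Ω → Prop} {q : ℝ} (h : ∀ ω, prob (fun x => Q (put ω x)) ≤ q) : prob Q ≤ q := by
  have := prob_le_of_fibers get put get_put put_put_get (P := fun _ => True) (Q := Q) (q := q)
    (fun ω => by rw [prob_true, mul_one]; exact h ω)
  rwa [prob_true, mul_one] at this

end prob

/-! ### Sampling -/

section sampling

/-- The elements of `W` that have at most half of `W` strictly below them are at least half
of `W`. -/
theorem card_le_two_mul_card_lowerHalf {V β : Type*} [DecidableEq V] [LinearOrder β] (W : Finset V) (d : V → β) :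
    W.card ≤ 2 * (W.filter fun c => 2 * (W.filter fun v => d v < d c).card ≤ W.card).card := by
  set H := W.filter fun c => 2 * (W.filter fun v => d v < d c).card ≤ W.card with hH
  rcases (W \ H).eq_empty_or_nonempty with h | h
  · have := Finset.card_le_card (Finset.sdiff_eq_empty_iff_subset.1 h)
    omega
  -- For a minimal `c` outside `H`, everything strictly below `c` lies in `H`, and that is already
  -- more than half of `W`.
  · obtain ⟨c, hc, hmin⟩ := Finset.exists_min_image _ d h
    obtain ⟨hcW, hcH⟩ := Finset.mem_sdiff.1 hc
    have h1 : W.card < 2 * (W.filter fun v => d v < d c).card := by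
      by_contra! hle
      exact hcH (Finset.mem_filter.2 ⟨hcW, hle⟩)
    have h2 : (W.filter fun v => d v < d c) ⊆ H := by
      intro v hv
      obtain ⟨hvW, hlt⟩ := Finset.mem_filter.1 hv
      by_contra hvH
      exact absurd (hmin v (Finset.mem_sdiff.2 ⟨hvW, hvH⟩)) (not_le.2 hlt)
    have := Finset.card_le_card h2
    omega

variable {V : Type*} [Fintype V] [DecidableEq V] {R : ℕ}

/-- A union bound over ordered pairs; two distinct nodes collide with probability 1 / (R + 1), all
other ranks being fixed. -/
theorem prob_not_injective_le (hR : 4 * Fintype.card V ^ 2 ≤ R + 1) :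
    prob (fun r : V → Fin (R + 1) => ¬ Function.Injective r) ≤ 1 / 4 := by
  have hpair : ∀ z : V × V, prob (fun r : V → Fin (R + 1) => z.1 ≠ z.2 ∧ r z.1 = r z.2) ≤
      1 / (R + 1 : ℝ) := by
    rintro ⟨v, w⟩
    refine prob_le_of_fibers_le (fun r => r v) (fun r x => Function.update r v x) (by simp)
      (by simp) fun r => ?_
    by_cases hvw : v = w
    · simp only [hvw, ne_eq, not_true_eq_false, false_and, prob_false]
      positivity
    · have hwv : w ≠ v := fun h => hvw h.symm
      have : prob (fun x : Fin (R + 1) => x = r w) = 1 / (R + 1 : ℝ) := by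
        rw [prob_eq, Finset.filter_eq']
        simp
      refine (prob_mono fun x hx => ?_).trans this.le
      simpa [Function.update_of_ne hwv] using hx.2
  have hsub : prob (fun r : V → Fin (R + 1) => ¬ Function.Injective r) ≤
      prob (fun r : V → Fin (R + 1) =>
        ∃ z ∈ (Finset.univ : Finset (V × V)), z.1 ≠ z.2 ∧ r z.1 = r z.2) := by
    refine prob_mono fun r hr => ?_
    rw [Function.not_injective_iff] at hr
    obtain ⟨v, w, h, hne⟩ := hr
    exact ⟨(v, w), Finset.mem_univ _, hne, h⟩
  refine hsub.trans ((prob_exists_mem_le _ _).trans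
    ((Finset.sum_le_sum fun z _ => hpair z).trans ?_))
  rw [Finset.sum_const, Finset.card_univ, Fintype.card_prod, nsmul_eq_mul, mul_one_div,
    div_le_div_iff₀ (by positivity) (by norm_num)]
  have : ((4 * Fintype.card V ^ 2 : ℕ) : ℝ) ≤ (R + 1 : ℕ) := by exact_mod_cast hR
  push_cast at this ⊢
  linarith

/-- The element of maximal rank of a set `W` misses a subset `H` of at least half the size with
probability at most `3 / 4`. -/
theorem prob_argmax_not_mem_le {W H : Finset V} (hHW : H ⊆ W) (hcard : W.card ≤ 2 * H.card)
    (hR : 4 * Fintype.card V ^ 2 ≤ R + 1) :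
    prob (fun r : V → Fin (R + 1) => ∃ v ∈ W, v ∉ H ∧ ∀ w ∈ W, r w ≤ r v) ≤ 3 / 4 := by
  set E : V → (V → Fin (R + 1)) → Prop := fun v r =>
    Function.Injective r ∧ ∀ w ∈ W, r w ≤ r v with hE
  -- Swapping the ranks of `v` and `w` preserves the uniform distribution and exchanges the two
  -- events.
  have hsymm : ∀ v ∈ W, ∀ w ∈ W, prob (E v) ≤ prob (E w) := by
    intro v hv w hw
    rw [← prob_equiv (Equiv.arrowCongr (Equiv.swap v w) (Equiv.refl _)) (E w)]
    refine prob_mono fun r hr => ⟨?_, fun x hx => ?_⟩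
    · exact hr.1.comp (Equiv.swap v w).symm.injective
    · change r ((Equiv.swap v w).symm x) ≤ r ((Equiv.swap v w).symm w)
      rw [Equiv.symm_swap, Equiv.swap_apply_right]
      refine hr.2 _ ?_
      rw [Equiv.swap_apply_def]
      split_ifs
      · exact hw
      · exact hv
      · exact hx
  have hsum : ∑ v ∈ W, prob (E v) ≤ 1 := by
    refine sum_prob_le_one W E fun r v hv w hw h h' => ?_
    exact h.1 (le_antisymm (h'.2 v hv) (h.2 w hw))
  have hle : ∑ v ∈ W \ H, prob (E v) ≤ ∑ v ∈ H, prob (E v) := by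
    rcases (W \ H).eq_empty_or_nonempty with h | ⟨a, ha⟩
    · rw [h, Finset.sum_empty]
      exact Finset.sum_nonneg fun v _ => prob_nonneg _
    · have haW := (Finset.mem_sdiff.1 ha).1
      have h1 : ∑ v ∈ W \ H, prob (E v) ≤ (W \ H).card • prob (E a) :=
        Finset.sum_le_card_nsmul _ _ _ fun v hv => hsymm v (Finset.mem_sdiff.1 hv).1 a haW
      have h2 : H.card • prob (E a) ≤ ∑ v ∈ H, prob (E v) :=
        Finset.card_nsmul_le_sum _ _ _ fun v hv => hsymm a haW v (hHW hv)
      refine h1.trans (le_trans ?_ h2)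
      refine nsmul_le_nsmul_left (prob_nonneg _) ?_
      rw [Finset.card_sdiff_of_subset hHW]
      omega
  -- The events are disjoint and `W \ H` carries at most the mass of `H`. Ties among ranks add the
  -- remaining 1/4.
  have hhalf : ∑ v ∈ W \ H, prob (E v) ≤ 1 / 2 := by
    have := Finset.sum_sdiff hHW (f := fun v => prob (E v))
    linarith
  have hcover : prob (fun r : V → Fin (R + 1) => ∃ v ∈ W, v ∉ H ∧ ∀ w ∈ W, r w ≤ r v) ≤
      prob (fun r : V → Fin (R + 1) => ¬ Function.Injective r ∨ ∃ v ∈ W \ H, E v r) := by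
    refine prob_mono ?_
    rintro r ⟨v, hv, hvH, hmax⟩
    by_cases hr : Function.Injective r
    · exact .inr ⟨v, Finset.mem_sdiff.2 ⟨hv, hvH⟩, hr, hmax⟩
    · exact .inl hr
  have h1 := prob_or_le (fun r : V → Fin (R + 1) => ¬ Function.Injective r)
    (fun r => ∃ v ∈ W \ H, E v r)
  have h2 := prob_exists_mem_le (W \ H) E
  have h3 := prob_not_injective_le (V := V) hR
  linarith

end sampling

namespace Agent

variable {A : CongestAlgorithm ℕ ℝ≥0∞} {p : Params} {G : Network} {T : ℕ} {α ε : ℝ}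

/-! ### The success probability of the phases -/

/-- The source of each run is determined by coins other than the tape of that run. With those coins
fixed the source is a fixed node, and `hA` applies. -/
theorem prob_not_runsSucceed_le {δ : ℝ} (hid : ∀ v ∈ G.nodes, v < p.idBound)
    (hA : ∀ b, ∀ s ∈ G.nodes, prob (fun r : G.nodes → A.Tape =>
      ¬ A.SucceedsWithin (G.orient b) s T (SSSPSpec (G.orient b) α s) r) ≤ δ)
    (μ : G.nodes → Mem) :
    prob (fun ω : G.nodes → Coins A p => ¬ RunsSucceed T ω μ α) ≤ 3 * δ := by
  have h1 : prob (fun ω : G.nodes → Coins A p =>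
      ¬ A.SucceedsWithin (G.orient false) (sampledIn ω μ) T
        (SSSPSpec (G.orient false) α (sampledIn ω μ)) (fun w => (ω w).2.1)) ≤ δ := by
    refine prob_le_of_fibers_le (fun ω v => (ω v).2.1)
      (fun ω (r : G.nodes → A.Tape) v => ((ω v).1, r v, (ω v).2.2))
      (fun _ _ => rfl) (fun _ _ => rfl) fun ω => ?_
    obtain ⟨c, hc⟩ := exists_sampledIn_eq (ω := ω) (μ := μ) hid
    have e : ∀ r : G.nodes → A.Tape,
        sampledIn (fun v => ((ω v).1, r v, (ω v).2.2)) μ = c := fun r => hc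
    simp only [e]
    exact hA false c c.2
  have h2 : prob (fun ω : G.nodes → Coins A p =>
      ¬ A.SucceedsWithin (G.orient true) (sampledIn ω μ) T
        (SSSPSpec (G.orient true) α (sampledIn ω μ)) (fun w => (ω w).2.2.1)) ≤ δ := by
    refine prob_le_of_fibers_le (fun ω v => (ω v).2.2.1)
      (fun ω (r : G.nodes → A.Tape) v => ((ω v).1, (ω v).2.1, r v, (ω v).2.2.2))
      (fun _ _ => rfl) (fun _ _ => rfl) fun ω => ?_
    obtain ⟨c, hc⟩ := exists_sampledIn_eq (ω := ω) (μ := μ) hid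
    have e : ∀ r : G.nodes → A.Tape,
        sampledIn (fun v => ((ω v).1, (ω v).2.1, r v, (ω v).2.2.2)) μ = c := fun r => hc
    simp only [e]
    exact hA true c c.2
  have h3 : prob (fun ω : G.nodes → Coins A p =>
      ¬ A.SucceedsWithin (G.orient true) (farthest T ω μ).2 T
        (SSSPSpec (G.orient true) α (farthest T ω μ).2) (fun w => (ω w).2.2.2)) ≤ δ := by
    refine prob_le_of_fibers_le (fun ω v => (ω v).2.2.2)
      (fun ω (r : G.nodes → A.Tape) v => ((ω v).1, (ω v).2.1, (ω v).2.2.1, r v))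
      (fun _ _ => rfl) (fun _ _ => rfl) fun ω => ?_
    obtain ⟨u, hu, -⟩ := exists_farthest_eq (T := T) (ω := ω) (μ := μ) hid
    have e : ∀ r : G.nodes → A.Tape,
        (farthest T (fun v => ((ω v).1, (ω v).2.1, (ω v).2.2.1, r v)) μ).2 = u :=
      fun r => congrArg Prod.snd hu
    simp only [e]
    exact hA true u u.2
  have h : ∀ ω : G.nodes → Coins A p, ¬ RunsSucceed T ω μ α → _ ∨ _ ∨ _ := fun ω h => by
    unfold RunsSucceed at h
    rw [not_and_or, not_and_or] at h
    exact h
  refine (prob_mono h).trans ((prob_or_le _ _).trans ?_)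
  refine (add_le_add h1 ((prob_or_le _ _).trans (add_le_add h2 h3))).trans (le_of_eq ?_)
  ring

/-- The remaining candidates. -/
def candidates (μ : G.nodes → Mem) : Finset G.nodes :=
  Finset.univ.filter fun v => (μ v).cand = true

/-- The candidates that have at most half of the candidates closer to `u`. -/
def lowerHalf (u : ℕ) (μ : G.nodes → Mem) : Finset G.nodes :=
  (candidates μ).filter fun c : G.nodes =>
    2 * ((candidates μ).filter fun v : G.nodes => G.dist v u < G.dist c u).card ≤ (candidates μ).card

/-- There are candidates, but the sampled node is not among those in the half closer to `u`. -/
def Misses (u : ℕ) (ω : G.nodes → Coins A p) (μ : G.nodes → Mem) : Prop :=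
  (candidates μ).Nonempty ∧ ∀ c : G.nodes, sampledIn ω μ = c → c ∉ lowerHalf u μ

/-- It is essential that `u` and the memories `μ` are fixed before the ranks are drawn. -/
theorem prob_misses_le (hid : ∀ v ∈ G.nodes, v < p.idBound)
    (hR : 4 * G.nodes.card ^ 2 ≤ p.ranks + 1) (u : ℕ) (μ : G.nodes → Mem) :
    prob (fun ω : G.nodes → Coins A p => Misses u ω μ) ≤ 3 / 4 := by
  refine prob_le_of_fibers_le (fun ω v => (ω v).1)
    (fun ω (r : G.nodes → Fin (p.ranks + 1)) v => (r v, (ω v).2))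
    (fun _ _ => rfl) (fun _ _ => rfl) fun ω => ?_
  refine (prob_mono ?_).trans (prob_argmax_not_mem_le (W := candidates μ) (H := lowerHalf u μ)
    (Finset.filter_subset _ _) (card_le_two_mul_card_lowerHalf (candidates μ) fun v : G.nodes => G.dist v u)
    (by rwa [Fintype.card_coe]))
  rintro r ⟨⟨a, ha⟩, hmiss⟩
  obtain ⟨w, hw, hmax⟩ := Network.leader_spec hid fun v => if (μ v).cand then (r v : ℕ) + 1 else 0
  have hcand : ∀ v ∈ candidates μ, (μ v).cand = true := fun v hv => (Finset.mem_filter.1 hv).2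
  have hwc : (μ w).cand = true := by
    by_contra hc
    have := hmax a
    simp [hcand a ha, hc] at this
  refine ⟨w, Finset.mem_filter.2 ⟨Finset.mem_univ _, hwc⟩, hmiss w (congrArg Prod.snd hw),
    fun v hv => ?_⟩
  have := hmax v
  simpa [hcand v hv, hwc] using this

theorem memAfter_congr {ρ ρ' : G.nodes → CoinTape A p} {t : ℕ}
    (h : ∀ s < t, ∀ v, ρ v (Fin.ofNat _ s) = ρ' v (Fin.ofNat _ s)) :
    memAfter T ρ t = memAfter T ρ' t := by
  induction t with
  | zero => rfl
  | succ t ih =>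
    rw [memAfter, memAfter, ih fun s hs => h s (by omega)]
    congr 1
    funext v
    exact h t (Nat.lt_succ_self t) v

/-- Change the coins of the `t`-th phase. -/
def setCoins (t : ℕ) (ρ : G.nodes → CoinTape A p) (ω : G.nodes → Coins A p) :
    G.nodes → CoinTape A p :=
  fun v => Function.update (ρ v) (Fin.ofNat _ t) (ω v)

theorem setCoins_self (t : ℕ) (ρ : G.nodes → CoinTape A p) (ω : G.nodes → Coins A p) :
    (fun v => setCoins t ρ ω v (Fin.ofNat _ t)) = ω := by
  funext v
  simp [setCoins]

theorem setCoins_setCoins (t : ℕ) (ρ : G.nodes → CoinTape A p) (ω : G.nodes → Coins A p) :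
    setCoins t (setCoins t ρ ω) (fun v => ρ v (Fin.ofNat _ t)) = ρ := by
  funext v
  simp [setCoins]

theorem setCoins_of_lt {s t : ℕ} (hst : s < t) (ht : t ≤ p.phases)
    (ρ : G.nodes → CoinTape A p) (ω : G.nodes → Coins A p) (v : G.nodes) :
    setCoins t ρ ω v (Fin.ofNat _ s) = ρ v (Fin.ofNat _ s) := by
  refine Function.update_of_ne (fun h => ?_) _ _
  have := congrArg Fin.val h
  simp only [Fin.ofNat] at this
  rw [Nat.mod_eq_of_lt (by omega), Nat.mod_eq_of_lt (by omega)] at this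
  omega

theorem memAfter_setCoins {s t : ℕ} (hst : s ≤ t) (ht : t ≤ p.phases)
    (ρ : G.nodes → CoinTape A p) (ω : G.nodes → Coins A p) :
    memAfter T (setCoins t ρ ω) s = memAfter T ρ s :=
  memAfter_congr fun _ hs v => setCoins_of_lt (hs.trans_le hst) ht ρ ω v

theorem prob_not_runsSucceed_memAfter_le {δ : ℝ} (hid : ∀ v ∈ G.nodes, v < p.idBound)
    (hA : ∀ b, ∀ s ∈ G.nodes, prob (fun r : G.nodes → A.Tape =>
      ¬ A.SucceedsWithin (G.orient b) s T (SSSPSpec (G.orient b) α s) r) ≤ δ)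
    {t : ℕ} (ht : t ≤ p.phases) :
    prob (fun ρ : G.nodes → CoinTape A p =>
      ¬ RunsSucceed T (fun v => ρ v (Fin.ofNat _ t)) (memAfter T ρ t) α) ≤ 3 * δ := by
  refine prob_le_of_fibers_le (fun ρ v => ρ v (Fin.ofNat _ t)) (setCoins t) (setCoins_self t)
    (setCoins_setCoins t) fun ρ => ?_
  simp only [memAfter_setCoins le_rfl ht]
  simp only [setCoins, Function.update_self]
  exact prob_not_runsSucceed_le hid hA _

/-- The probability to miss in `m` successive phases. -/
theorem prob_forall_misses_le (hid : ∀ v ∈ G.nodes, v < p.idBound)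
    (hR : 4 * G.nodes.card ^ 2 ≤ p.ranks + 1) (u a m : ℕ) (ham : a + m ≤ p.phases + 1) :
    prob (fun ρ : G.nodes → CoinTape A p => ∀ s < m,
      Misses u (fun v => ρ v (Fin.ofNat _ (a + s))) (memAfter T ρ (a + s))) ≤ (3 / 4) ^ m := by
  induction m with
  | zero => exact (prob_le_one _).trans_eq (pow_zero _).symm
  | succ m ih =>
    -- Fix all coins except those of phase `a + m`. The earlier phases and the memories before this
    -- phase do not depend on them, so the new miss costs a further factor 3/4.
    refine le_trans (prob_le_of_fibers (fun ρ v => ρ v (Fin.ofNat _ (a + m))) (setCoins (a + m))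
      (setCoins_self (a + m)) (setCoins_setCoins (a + m)) (q := 3 / 4)
      (P := fun ρ => ∀ s < m,
        Misses u (fun v => ρ v (Fin.ofNat _ (a + s))) (memAfter T ρ (a + s))) fun ρ => ?_) ?_
    · have hconst : ∀ ω : G.nodes → Coins A p, (∀ s < m,
          Misses u (fun v => setCoins (a + m) ρ ω v (Fin.ofNat _ (a + s)))
            (memAfter T (setCoins (a + m) ρ ω) (a + s))) ↔ ∀ s < m,
          Misses u (fun v => ρ v (Fin.ofNat _ (a + s))) (memAfter T ρ (a + s)) := by
        intro ω
        refine forall₂_congr fun s hs => ?_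
        rw [memAfter_setCoins (by omega) (by omega)]
        simp only [setCoins_of_lt (p := p) (show a + s < a + m by omega) (by omega)]
      by_cases hP : ∀ s < m,
          Misses u (fun v => ρ v (Fin.ofNat _ (a + s))) (memAfter T ρ (a + s))
      · simp only [hconst]
        rw [show (fun _ : G.nodes → Coins A p => ∀ s < m, Misses u
          (fun v => ρ v (Fin.ofNat _ (a + s))) (memAfter T ρ (a + s))) = fun _ => True from
          funext fun _ => eq_true hP, prob_true, mul_one]
        refine le_trans (prob_mono fun ω h => ?_)
          (prob_misses_le hid hR u (memAfter T ρ (a + m)))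
        have := h m (Nat.lt_succ_self m)
        rwa [memAfter_setCoins le_rfl (by omega), setCoins_self] at this
      · refine le_trans (prob_mono (Q := fun _ => False) fun ω h => ?_)
          (prob_false.trans_le (mul_nonneg (by norm_num) (prob_nonneg _)))
        exact hP ((hconst ω).1 fun s hs => h s (by omega))
    · rw [pow_succ, mul_comm]
      exact mul_le_mul_of_nonneg_right (ih (by omega)) (by norm_num)

/-! ### The number of candidates -/

section candidates

variable (hid : ∀ v ∈ G.nodes, v < p.idBound) (hratio : p.ratio = ENNReal.ofReal (1 + ε))
  (hpos : 0 < p.top) (htop : ∀ u v, G.dist u v = ⊤ ∨ G.dist u v < p.top)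
  {ρ : G.nodes → CoinTape A p}
  (hruns : ∀ s < p.phases, RunsSucceed T (fun v => ρ v (Fin.ofNat _ s)) (memAfter T ρ s) (1 + ε))

theorem candidates_subset {s t : ℕ} (hst : s ≤ t) :
    candidates (memAfter T ρ t) ⊆ candidates (memAfter T ρ s) := by
  induction t, hst using Nat.le_induction with
  | base => exact subset_rfl
  | succ t _ ih =>
    intro v hv
    refine ih (Finset.mem_filter.2 ⟨Finset.mem_univ _, ?_⟩)
    exact ((cand_phaseStep v).1 (Finset.mem_filter.1 hv).2).1

theorem center_memAfter {s t : ℕ} (hst : s ≤ t) {c : G.nodes}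
    (hc : (memAfter T ρ s c).center = true) : (memAfter T ρ t c).center = true := by
  induction t, hst using Nat.le_induction with
  | base => exact hc
  | succ t _ ih => exact (center_phaseStep c).2 (.inl ih)

-- Let `u` be the node selected in the last phase of the batch. Some phase of the batch sampled a
-- `c` in the half closer to this `u`. Candidates surviving the last phase are strictly closer to
-- `u` than `c`, so they are at most half of the candidates present when `c` was sampled.
include hid hratio hpos htop hruns in
theorem two_mul_card_candidates_le {a m : ℕ} (hm : 0 < m) (ham : a + m ≤ p.phases)
    (hhit : ∀ u : G.nodes, ∃ s < m,
      ¬ Misses u (fun v => ρ v (Fin.ofNat _ (a + s))) (memAfter T ρ (a + s))) :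
    2 * (candidates (memAfter T ρ (a + m))).card ≤ (candidates (memAfter T ρ a)).card := by
  obtain ⟨m, rfl⟩ := Nat.exists_eq_succ_of_ne_zero hm.ne'
  obtain ⟨u, hu, -⟩ := exists_farthest_eq (T := T) (ω := fun v => ρ v (Fin.ofNat _ (a + m)))
    (μ := memAfter T ρ (a + m)) hid
  obtain ⟨s, hs, hmiss⟩ := hhit u
  have hle := Finset.card_le_card (candidates_subset (T := T) (ρ := ρ) (Nat.le_add_right a s))
  refine le_trans ?_ hle
  have hsub := candidates_subset (T := T) (ρ := ρ) (show a + s ≤ a + (m + 1) by omega)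
  rcases (candidates (memAfter T ρ (a + s))).eq_empty_or_nonempty with h0 | hne
  · rw [h0, Finset.subset_empty] at hsub
    rw [Nat.succ_eq_add_one, hsub]
    simp
  · have hmem : ∃ c : G.nodes, sampledIn (fun v => ρ v (Fin.ofNat _ (a + s)))
        (memAfter T ρ (a + s)) = c ∧ c ∈ lowerHalf u (memAfter T ρ (a + s)) := by
      by_contra! hc
      exact hmiss ⟨hne, hc⟩
    obtain ⟨c, hc, hcl⟩ := hmem
    refine le_trans (Nat.mul_le_mul_left 2 (Finset.card_le_card ?_)) (Finset.mem_filter.1 hcl).2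
    intro v hv
    refine Finset.mem_filter.2 ⟨hsub hv, ?_⟩
    have hcenter : (memAfter T ρ (a + m + 1) c).center = true :=
      center_memAfter (s := a + s + 1) (by omega) ((center_phaseStep c).2 (.inr hc.symm))
    have := dist_lt_of_cand_phaseStep hid hratio htop (hruns (a + m) (by omega))
      (invariant_memAfter hid hratio hpos htop (a + m) fun s hs => hruns s (by omega))
      (Finset.mem_filter.1 hv).2 c hcenter
    rwa [hu] at this

include hid hratio hpos htop hruns in
theorem card_candidates_mul_le {m : ℕ} (hm : 0 < m) (i : ℕ) (him : i * m ≤ p.phases)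
    (hhit : ∀ j < i, ∀ u : G.nodes, ∃ s < m,
      ¬ Misses u (fun v => ρ v (Fin.ofNat _ (j * m + s))) (memAfter T ρ (j * m + s))) :
    2 ^ i * (candidates (memAfter T ρ (i * m))).card ≤ G.nodes.card := by
  induction i with
  | zero =>
    rw [pow_zero, one_mul]
    exact (Finset.card_le_univ _).trans_eq (Fintype.card_coe _)
  | succ i ih =>
    rw [Nat.succ_mul] at him ⊢
    have h1 := two_mul_card_candidates_le hid hratio hpos htop hruns hm him
      (hhit i (Nat.lt_succ_self i))
    have h2 := ih (by omega) fun j hj => hhit j (by omega)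
    calc 2 ^ (i + 1) * (candidates (memAfter T ρ (i * m + m))).card
        = 2 ^ i * (2 * (candidates (memAfter T ρ (i * m + m))).card) := by ring
      _ ≤ 2 ^ i * (candidates (memAfter T ρ (i * m))).card := Nat.mul_le_mul_left _ h1
      _ ≤ _ := h2

end candidates

/-- The success probability of the eccentricity algorithm with `i` batches of `m` phases. -/
theorem le_successProb_eccAlgorithm {δ : ℝ} {i m R : ℕ} (hε : 0 ≤ ε)
    (hid : ∀ v ∈ G.nodes, v < p.idBound) (hratio : p.ratio = ENNReal.ofReal (1 + ε))
    (hpos : 0 < p.top) (htop : ∀ u v, G.dist u v = ⊤ ∨ G.dist u v < p.top)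
    (hR : 4 * G.nodes.card ^ 2 ≤ p.ranks + 1) (hm : 0 < m) (hphases : p.phases = i * m)
    (hi : G.nodes.card < 2 ^ i) (hD : 0 < G.hopDiam)
    (hA : ∀ b, ∀ s ∈ G.nodes, prob (fun r : G.nodes → A.Tape =>
      ¬ A.SucceedsWithin (G.orient b) s T (SSSPSpec (G.orient b) (1 + ε) s) r) ≤ δ)
    (hrounds : (68 * p.phases + 76) * (T + G.hopDiam) ≤ R) :
    1 - (p.phases * (3 * δ) + i * (G.nodes.card * (3 / 4) ^ m)) ≤
      (eccAlgorithm A p).successProb G () R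
        (EccSpec G (2 + ε ^ 3 + 3 * ε ^ 2 + 4 * ε) ((1 + ε) ^ 2) p.phases) := by
  set Bad₁ : (G.nodes → CoinTape A p) → Prop := fun ρ => ∃ t ∈ Finset.range p.phases,
    ¬ RunsSucceed T (fun v => ρ v (Fin.ofNat _ t)) (memAfter T ρ t) (1 + ε) with hBad₁
  -- The union ranges over all nodes `u`, since the node selected at the end of a batch depends on
  -- the coins of the batch.
  set Bad₂ : (G.nodes → CoinTape A p) → Prop := fun ρ => ∃ j ∈ Finset.range i,
    ∃ u ∈ (Finset.univ : Finset G.nodes), ∀ s < m,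
      Misses u (fun v => ρ v (Fin.ofNat _ (j * m + s))) (memAfter T ρ (j * m + s)) with hBad₂
  have h1 : prob Bad₁ ≤ p.phases * (3 * δ) := by
    refine (prob_exists_mem_le _ _).trans ((Finset.sum_le_card_nsmul _ _ (3 * δ)
      fun t ht => prob_not_runsSucceed_memAfter_le hid hA (Finset.mem_range.1 ht).le).trans_eq ?_)
    rw [Finset.card_range, nsmul_eq_mul]
  have h2 : prob Bad₂ ≤ i * (G.nodes.card * (3 / 4) ^ m) := by
    refine (prob_exists_mem_le _ _).trans ((Finset.sum_le_card_nsmul _ _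
      ((G.nodes.card : ℝ) * (3 / 4) ^ m) fun j hj => ?_).trans_eq ?_)
    · refine (prob_exists_mem_le _ _).trans ((Finset.sum_le_card_nsmul _ _ ((3 / 4) ^ m)
        fun u _ => prob_forall_misses_le (T := T) hid hR u.1 (j * m) m ?_).trans_eq ?_)
      · have := Nat.mul_le_mul_right m (Finset.mem_range.1 hj)
        rw [Nat.succ_mul] at this
        omega
      · rw [Finset.card_univ, Fintype.card_coe, nsmul_eq_mul]
    · rw [Finset.card_range, nsmul_eq_mul]
  have hgood : ∀ ρ : G.nodes → CoinTape A p, ¬ (Bad₁ ρ ∨ Bad₂ ρ) →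
      (eccAlgorithm A p).SucceedsWithin G () R
        (EccSpec G (2 + ε ^ 3 + 3 * ε ^ 2 + 4 * ε) ((1 + ε) ^ 2) p.phases) ρ := by
    intro ρ hρ
    rw [not_or] at hρ
    have hruns : ∀ s < p.phases,
        RunsSucceed T (fun v => ρ v (Fin.ofNat _ s)) (memAfter T ρ s) (1 + ε) := by
      intro s hs
      by_contra hc
      exact hρ.1 ⟨s, Finset.mem_range.2 hs, hc⟩
    have hcard := card_candidates_mul_le hid hratio hpos htop hruns hm i hphases.ge
      fun j hj u => by
        by_contra! hc
        exact hρ.2 ⟨j, Finset.mem_range.2 hj, u, Finset.mem_univ _, hc⟩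
    have hzero : (candidates (memAfter T ρ p.phases)).card = 0 := by
      rw [hphases]
      by_contra hne
      have := Nat.mul_le_mul_left (2 ^ i) (Nat.one_le_iff_ne_zero.2 hne)
      omega
    refine ⟨_, output_eccAlgorithm hid hruns hD hrounds, ?_⟩
    refine eccSpec_of_invariant hid hε hratio
      (invariant_memAfter hid hratio hpos htop p.phases hruns) (toC_memAfter_le _ _ _)
      (fun v => ?_) (card_center_memAfter_le _ _)
    rw [Finset.card_eq_zero] at hzero
    by_contra hc
    have : v ∈ candidates (memAfter T ρ p.phases) :=
      Finset.mem_filter.2 ⟨Finset.mem_univ _, by simpa using hc⟩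
    rw [hzero] at this
    simp at this
  have h3 := prob_or_le Bad₁ Bad₂
  have h4 := prob_not (fun ρ => Bad₁ ρ ∨ Bad₂ ρ)
  have h5 : prob (fun ρ => ¬ (Bad₁ ρ ∨ Bad₂ ρ)) ≤ (eccAlgorithm A p).successProb G () R
      (EccSpec G (2 + ε ^ 3 + 3 * ε ^ 2 + 4 * ε) ((1 + ε) ^ 2) p.phases) := prob_mono hgood
  linarith

end Agent

/-! ### Choice of the parameters and final estimates -/

/-- An algorithm in which nobody does anything. -/
def CongestAlgorithm.idle (Input Out : Type) : CongestAlgorithm Input Out where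
  Tape := Unit
  tapeFintype := inferInstance
  tapeNonempty := inferInstance
  Msg := Empty
  msgFintype := inferInstance
  State := Unit
  init _ _ _ := ()
  send _ _ := none
  receive _ _ := ()
  output _ := none
  output_final _ _ _ h := h

theorem CongestAlgorithm.successProb_nonneg {Input Out : Type} (A : CongestAlgorithm Input Out)
    (G : Network) (x : Input) (R : ℕ) (spec : (G.nodes → Out) → Prop) :
    0 ≤ A.successProb G x R spec :=
  prob_nonneg _

/-- The parameters for networks with `n` nodes, and failure probability about `1 / n ^ c`. -/
def eccParams (c κ ι n : ℕ) (ε : ℝ) : Params where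
  idBound := n ^ ι
  -- One more than the largest possible finite distance.
  top := n * n ^ κ + 1
  -- Enough ranks for ties to have probability at most 1/4.
  ranks := 4 * n ^ 2
  -- The first factor is the number of batches, enough to halve `n` below 1; the second is the
  -- length of a batch, enough for a miss probability of at most `1 / n ^ (c + 4)` for each fixed
  -- target.
  phases := (Nat.log 2 n + 1) * (3 * (c + 4) * (Nat.log 2 n + 1))
  ratio := ENNReal.ofReal (1 + ε)

theorem eccParams_phases_le (c κ ι : ℕ) {n : ℕ} (ε : ℝ) (hn : 2 ≤ n) :
    (eccParams c κ ι n ε).phases ≤ 12 * (c + 4) * Nat.log 2 n ^ 2 := by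
  have hlog : 1 ≤ Nat.log 2 n := Nat.log_pos one_lt_two hn
  have h : Nat.log 2 n + 1 ≤ 2 * Nat.log 2 n := by omega
  calc (Nat.log 2 n + 1) * (3 * (c + 4) * (Nat.log 2 n + 1))
      ≤ (2 * Nat.log 2 n) * (3 * (c + 4) * (2 * Nat.log 2 n)) := by gcongr
    _ = _ := by ring

theorem eccParams_keyBound_le (c κ ι : ℕ) {n : ℕ} (ε : ℝ) (hn : 2 ≤ n) :
    (eccParams c κ ι n ε).keyBound + 1 ≤ n ^ (κ + ι + 7) := by
  have h1 : 1 ≤ n ^ κ := Nat.one_le_pow _ _ (by omega)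
  have h2 : 1 ≤ n ^ ι := Nat.one_le_pow _ _ (by omega)
  have h3 : 4 * n ^ 2 + (n * n ^ κ + 1) + 2 ≤ n ^ κ * (8 * n ^ 3) := by
    have h4 : 4 ≤ n ^ 2 := by nlinarith
    have h5 : 2 * n ^ 2 ≤ n ^ 3 := by rw [pow_succ n 2, mul_comm]; gcongr
    have h6 : n ≤ n ^ 3 := Nat.le_self_pow (by norm_num) n
    have h7 : n ^ 3 ≤ n ^ κ * n ^ 3 := Nat.le_mul_of_pos_left _ h1
    have h8 : n * n ^ κ ≤ n ^ κ * n ^ 3 := by rw [mul_comm]; gcongr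
    nlinarith
  have h9 : 8 ≤ n ^ 3 := by
    calc 8 = 2 ^ 3 := by norm_num
      _ ≤ n ^ 3 := Nat.pow_le_pow_left hn 3
  have h10 : 2 * (n ^ κ * n ^ ι * n ^ 6) ≤ n ^ (κ + ι + 7) := by
    calc 2 * (n ^ κ * n ^ ι * n ^ 6) ≤ n * (n ^ κ * n ^ ι * n ^ 6) := by gcongr
      _ = _ := by ring
  refine le_trans ?_ h10
  have h11 : (4 * n ^ 2 + (n * n ^ κ + 1) + 2) * n ^ ι ≤ n ^ κ * n ^ ι * n ^ 6 := by
    calc (4 * n ^ 2 + (n * n ^ κ + 1) + 2) * n ^ ι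
        ≤ (n ^ κ * (n ^ 3 * n ^ 3)) * n ^ ι := by
          refine Nat.mul_le_mul_right _ (h3.trans ?_)
          gcongr
      _ = _ := by ring
  have h12 : 1 ≤ n ^ κ * n ^ ι * n ^ 6 :=
    Nat.mul_pos (Nat.mul_pos h1 h2) (Nat.pow_pos (by omega))
  change (4 * n ^ 2 + (n * n ^ κ + 1) + 2) * n ^ ι + 1 ≤ _
  omega

/-- Three misses have probability (3/4)³ = 27/64 < 1/2. -/
theorem three_quarters_pow_le {c n : ℕ} (hn : 2 ≤ n) :
    (3 / 4 : ℝ) ^ (3 * (c + 4) * (Nat.log 2 n + 1)) ≤ 1 / (n : ℝ) ^ (c + 4) := by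
  have hn' : (n : ℝ) ≤ 2 ^ (Nat.log 2 n + 1) := by
    exact_mod_cast (Nat.lt_pow_succ_log_self one_lt_two n).le
  have hpos : (0 : ℝ) < n := by positivity
  calc (3 / 4 : ℝ) ^ (3 * (c + 4) * (Nat.log 2 n + 1))
      = ((3 / 4 : ℝ) ^ 3) ^ ((Nat.log 2 n + 1) * (c + 4)) := by
        rw [← pow_mul]
        congr 1
        ring
    _ ≤ (1 / 2 : ℝ) ^ ((Nat.log 2 n + 1) * (c + 4)) := by
        gcongr
        norm_num
    _ = 1 / (2 ^ (Nat.log 2 n + 1)) ^ (c + 4) := by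
        rw [one_div_pow, pow_mul]
    _ ≤ 1 / (n : ℝ) ^ (c + 4) := by gcongr

/-- Each of the two summands is at most n^(-c-1), hence at most half of n^(-c). In the first, the
extra exponent `9 * (c + 4)` of the given algorithm absorbs the constant factor `9 * (c + 4)`, as x
≤ 2^x ≤ n^x. -/
theorem failure_bound (c κ ι : ℕ) {n : ℕ} (ε : ℝ) (hn : 2 ≤ n) :
    ((eccParams c κ ι n ε).phases : ℝ) * (3 * (1 / (n : ℝ) ^ (c + 3 + 9 * (c + 4)))) +
      (Nat.log 2 n + 1 : ℕ) * (n * (3 / 4) ^ (3 * (c + 4) * (Nat.log 2 n + 1))) ≤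
        1 / (n : ℝ) ^ c := by
  have hpos : (0 : ℝ) < n := by positivity
  have hn2 : (2 : ℝ) ≤ n := by exact_mod_cast hn
  have hlog : Nat.log 2 n + 1 ≤ n := Nat.log_lt_self 2 (by omega)
  have hlog' : ((Nat.log 2 n + 1 : ℕ) : ℝ) ≤ n := by exact_mod_cast hlog
  have hbig : ((9 * (c + 4) : ℕ) : ℝ) ≤ (n : ℝ) ^ (9 * (c + 4)) := by
    calc ((9 * (c + 4) : ℕ) : ℝ) ≤ (2 : ℝ) ^ (9 * (c + 4)) := by
          exact_mod_cast Nat.lt_two_pow_self.le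
      _ ≤ _ := by gcongr
  have h1 : ((eccParams c κ ι n ε).phases : ℝ) * (3 * (1 / (n : ℝ) ^ (c + 3 + 9 * (c + 4)))) ≤
      1 / (n : ℝ) ^ (c + 1) := by
    have hph : ((eccParams c κ ι n ε).phases : ℝ) * 3 ≤ (9 * (c + 4) : ℕ) * (n : ℝ) ^ 2 := by
      have : (eccParams c κ ι n ε).phases * 3 ≤ 9 * (c + 4) * n ^ 2 := by
        calc (Nat.log 2 n + 1) * (3 * (c + 4) * (Nat.log 2 n + 1)) * 3
            ≤ n * (3 * (c + 4) * n) * 3 := by gcongr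
          _ = _ := by ring
      exact_mod_cast this
    rw [← mul_assoc, mul_one_div, div_le_div_iff₀ (by positivity) (by positivity), one_mul]
    calc ((eccParams c κ ι n ε).phases : ℝ) * 3 * (n : ℝ) ^ (c + 1)
        ≤ (n : ℝ) ^ (9 * (c + 4)) * (n : ℝ) ^ 2 * (n : ℝ) ^ (c + 1) := by
          exact mul_le_mul_of_nonneg_right
            (hph.trans (mul_le_mul_of_nonneg_right hbig (by positivity))) (by positivity)
      _ = _ := by
          rw [← pow_add, ← pow_add]
          congr 1
          ring
  have h2 : ((Nat.log 2 n + 1 : ℕ) : ℝ) *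
      (n * (3 / 4) ^ (3 * (c + 4) * (Nat.log 2 n + 1))) ≤ 1 / (n : ℝ) ^ (c + 1) := by
    calc ((Nat.log 2 n + 1 : ℕ) : ℝ) * (n * (3 / 4) ^ (3 * (c + 4) * (Nat.log 2 n + 1)))
        ≤ n * (n * (1 / (n : ℝ) ^ (c + 4))) := by
          gcongr
          exact three_quarters_pow_le hn
      _ = 1 / (n : ℝ) ^ (c + 2) := by
          field_simp
          ring
      _ ≤ 1 / (n : ℝ) ^ (c + 1) := by
          gcongr
          · linarith
          · omega
  have h3 : 1 / (n : ℝ) ^ (c + 1) ≤ 1 / 2 * (1 / (n : ℝ) ^ c) := by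
    rw [pow_succ, one_div_mul_one_div, mul_comm (2 : ℝ)]
    gcongr
  linarith

/-- On networks with at least two nodes, the eccentricity algorithm works. -/
theorem solvesEcc_eccAlgorithm {c κ ι b n : ℕ} {ε : ℝ} {𝓦 : Set ℕ} {T : ℕ → ℕ} (hn : 2 ≤ n)
    (hε : 0 ≤ ε) (h𝓦 : ∀ a ∈ 𝓦, a ≤ n ^ κ) {A : CongestAlgorithm ℕ ℝ≥0∞}
    (hA : A.SolvesSSSP n ι 𝓦 (1 + ε) b (c + 3 + 9 * (c + 4)) T) :
    (eccAlgorithm A (eccParams c κ ι n ε)).SolvesEcc n ι 𝓦 (2 + ε ^ 3 + 3 * ε ^ 2 + 4 * ε)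
      ((1 + ε) ^ 2) ((1000 * (c + 4)) * Nat.log 2 n ^ 2) (b + κ + ι + 8) c
      (fun D => (1000 * (c + 4)) * Nat.log 2 n ^ 2 * (T D + D)) := by
  have hphases := eccParams_phases_le c κ ι ε hn
  have hlog : 1 ≤ Nat.log 2 n := Nat.log_pos one_lt_two hn
  have hlog2 : 1 ≤ Nat.log 2 n ^ 2 := Nat.one_le_pow _ _ hlog
  refine ⟨?_, fun G hG => ?_⟩
  · change Fintype.card (A.Msg ⊕ Fin ((eccParams c κ ι n ε).keyBound + 1)) ≤ _
    rw [Fintype.card_sum, Fintype.card_fin]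
    have h1 : n ^ b ≤ n ^ (b + κ + ι + 7) := Nat.pow_le_pow_right (by omega) (by omega)
    have h2 : n ^ (κ + ι + 7) ≤ n ^ (b + κ + ι + 7) := Nat.pow_le_pow_right (by omega) (by omega)
    have h3 : n ^ (b + κ + ι + 7) * 2 ≤ n ^ (b + κ + ι + 8) := by
      rw [pow_succ n (b + κ + ι + 7)]
      gcongr
    have := hA.1
    have := eccParams_keyBound_le c κ ι ε hn
    omega
  · have hw : ∀ u v a, G.weight u v = some a → a ≤ n ^ κ := fun u v a h => h𝓦 a (hG.2.2 u v a h)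
    have hD : 0 < G.hopDiam := G.hopDiam_pos (by rw [hG.1]; omega)
    have hfail : ∀ b, ∀ s ∈ G.nodes, prob (fun r : G.nodes → A.Tape =>
        ¬ A.SucceedsWithin (G.orient b) s (T G.hopDiam)
          (SSSPSpec (G.orient b) (1 + ε) s) r) ≤ 1 / (n : ℝ) ^ (c + 3 + 9 * (c + 4)) := by
      intro b s hs
      have h := hA.2 (G.orient b) (G.orient_inClass hG b) s hs
      rw [G.orient_hopDiam b] at h
      have h' := prob_not fun r : G.nodes → A.Tape => A.SucceedsWithin (G.orient b) s
        (T G.hopDiam) (SSSPSpec (G.orient b) (1 + ε) s) r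
      change _ ≤ prob (fun r : G.nodes → A.Tape => A.SucceedsWithin (G.orient b) s (T G.hopDiam)
        (SSSPSpec (G.orient b) (1 + ε) s) r) at h
      linarith
    have key := Agent.le_successProb_eccAlgorithm (A := A) (p := eccParams c κ ι n ε) (G := G)
      (T := T G.hopDiam) (ε := ε) (i := Nat.log 2 n + 1) (m := 3 * (c + 4) * (Nat.log 2 n + 1))
      (R := (1000 * (c + 4)) * Nat.log 2 n ^ 2 * (T G.hopDiam + G.hopDiam)) hε
      hG.2.1 rfl (Nat.succ_pos _) (fun u v => ?_) (by rw [hG.1]; exact Nat.le_succ _) (by positivity)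
      rfl (by rw [hG.1]; exact Nat.lt_pow_succ_log_self one_lt_two n) hD hfail ?_
    · rw [hG.1] at key
      have hb := failure_bound c κ ι ε hn
      refine le_trans (by linarith) (key.trans (prob_mono ?_))
      rintro ρ ⟨f, hf, hspec⟩
      exact ⟨f, hf, hspec.1, hspec.2.1, hspec.2.2.trans
        (hphases.trans (Nat.mul_le_mul_right _ (by omega)))⟩
    · refine (Network.dist_eq_top_or_le hw u v).imp_right fun h => lt_of_le_of_lt h ?_
      rw [hG.1]
      exact_mod_cast Nat.lt_succ_self _
    -- With at most `12 * (c + 4) * Nat.log 2 n ^ 2` phases, 68 · 12 = 816 leaves room below 1000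
    -- for the additive 76.
    · refine Nat.mul_le_mul_right _ ?_
      nlinarith

/-- On networks with at most one node, there is nothing to prove. -/
theorem CongestAlgorithm.solvesEcc_idle {n : ℕ} (hn : n ≤ 1) (ι : ℕ) (𝓦 : Set ℕ) (α β : ℝ)
    (m b c : ℕ) (R : ℕ → ℕ) :
    (CongestAlgorithm.idle Unit EccOutput).SolvesEcc n ι 𝓦 α β m b c R := by
  refine ⟨Nat.zero_le _, fun G hG => ?_⟩
  have hpos : 0 < n := by
    rw [← hG.1, Finset.card_pos]
    exact Finset.nonempty_coe_sort.1 G.comm_connected.nonempty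
  -- For a single node the required probability 1 - 1 / 1 ^ c is 0.
  obtain rfl : n = 1 := by omega
  simpa using CongestAlgorithm.successProb_nonneg _ G () (R G.hopDiam) (EccSpec G α β m)

end

/-- `1 / n ^ c` is the failure probability aimed at, and `1 / n ^ c₀` the one that is allowed to the
given SSSP algorithm. Weights are at most `n ^ κ`, identifiers are smaller than `n ^ ι`,
messages of the given algorithm have at most `b * log₂ n` bits. The constants `b'` (message size),
`K` and `k` (hidden in the number of rounds and in the size of the pseudo-center) depend on
`c`, `κ`, `ι`, `b` only; in particular not on `n`, `ε`, `T` or the set `𝓦` of admissible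
weights. -/
theorem mainTheorem1 (c : ℕ) :
    ∃ c₀ : ℕ, ∀ κ ι b : ℕ, ∃ b' K k : ℕ, ∀ (T : ℕ → ℝ → ℕ → ℕ) (n : ℕ) (ε : ℝ) (𝓦 : Set ℕ),
      0 ≤ ε → (∀ a ∈ 𝓦, a ≤ n ^ κ) →
      (∃ A : CongestAlgorithm ℕ ENNReal, A.SolvesSSSP n ι 𝓦 (1 + ε) b c₀ (T n ε)) →
      ∃ A' : CongestAlgorithm Unit EccOutput,
        A'.SolvesEcc n ι 𝓦 (2 + ε ^ 3 + 3 * ε ^ 2 + 4 * ε) ((1 + ε) ^ 2)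
          (K * Nat.log 2 n ^ 2) b' c
          (fun D => K * Nat.log 2 n ^ k * (T n ε D + D)) := by
  refine ⟨c + 3 + 9 * (c + 4), fun κ ι b => ⟨b + κ + ι + 8, 1000 * (c + 4), 2, ?_⟩⟩
  rintro T n ε 𝓦 hε h𝓦 ⟨A, hA⟩
  rcases Nat.lt_or_ge n 2 with hn | hn
  · exact ⟨_, CongestAlgorithm.solvesEcc_idle (by omega) ..⟩
  · exact ⟨_, solvesEcc_eccAlgorithm hn hε h𝓦 hA⟩
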